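/- Let $a,b,d$ be pairwise coprime positive integers such that $1<\min(a,b)<d$, $d\notin\langle a,b\rangle$ and $d$ does not divide $ab-a-b$. Here $\langle a,b\rangle=\{xa+yb : x,y\in\mathbb N\}$ and $\frac{\langle a,b\rangle}{d}=\{x\in\mathbb N : dx\in\langle a,b\rangle\}$. For a numerical semigroup $S$, $\mathrm{PF}(S)$ is the set of maximal elements of $\mathbb Z\setminus S$ for the order $x\leqslant_S y\Leftrightarrow y-x\in S$, and the type $t(S)$ is the cardinality of $\mathrm{PF}(S)$. Let $m\in\{1,\dots,d-1\}$ be such that $am+b\equiv 0 \pmod d$, and let $\alpha=\frac md$. Let $[0,a_1,\dots,a_r,1]$ be the continued fraction expansion of $\alpha$ that ends with $1$ (all $a_i\geqslant 1$), with convergents $\frac{p_i}{q_i}=[0,a_1,\dots,a_i]$ for $0\leqslant i\leqslant r$: $p_0=0$, $q_0=1$, $p_1=1$, $q_1=a_1$, and $p_i=a_ip_{i-1}+p_{i-2}$, $q_i=a_iq_{i-1}+q_{i-2}$ for $i\geqslant 2$. Let $\tau=\frac{am+b}{d}$ (a positive integer), $\beta=\{a\alpha\}=1-\left\{\frac bd\right\}$,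 and $\mu_i=\tau q_i-ap_i$ for $0\leqslant i\leqslant r$. A sequence $(e_1,\dots,e_r)$ of non-negative integers is called $\alpha$-admissible if, for every $j\in\{1,\dots,r\}$, $e_j\leqslant a_j$, and $e_j=0$ implies that either $e_i=0$ for all $i\geqslant j$, or $j\geqslant 2$ and $e_{j-1}=a_{j-1}$. The $\alpha$-numeration of $\beta$ is the $\alpha$-admissible sequence $(b_1,\dots,b_r)$ such that $\beta=\sum_{j=1}^r b_j(q_{j-1}\alpha-p_{j-1})$; we write it $(b_1,\dots,b_s)$, with $b_s>0$ and $b_i=0$ for $i>s$. Let $B=\{i\in\{1,\dots,\lfloor s/2\rfloor\} : b_{2i}\neq 0\}$; let $k_0=\min(B)$ if $B\neq\emptyset$, and $k_0=(s+1)/2$ if $B=\emptyset$ ($s$ is odd in that case). Let $$\mathcal F_0=\left\{a\left\lfloor\tfrac bd\right\rfloor-\tau\right\}\text{ if }\alpha<\beta,\qquad \mathcal F_0=\emptyset\text{ otherwise},$$ $$\mathcal F_1=\left\{a\left\lfloor\tfrac bd\right\rfloor-\mu_{2k-2}-j\mu_{2k-1} : 1\leqslant k\leqslant k_0-1,\ 1\leqslant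 j\leqslant a_{2k}\right\},$$ $$\mathcal F_2=\left\{a\left\lfloor\tfrac bd\right\rfloor+a-j\mu_{2k-1}-\sum_{i=1}^{2k-1}b_i\mu_{i-1} : k\in B,\ 0\leqslant j\leqslant b_{2k}-1\right\}.$$ Case 1: if $a<d<b$, then $\mathrm{PF}\left(\frac{\langle a,b\rangle}{d}\right)=\mathcal F_0\sqcup\mathcal F_1\sqcup\mathcal F_2$ (a disjoint union), and $$t\left(\tfrac{\langle a,b\rangle}{d}\right)=\sum_{k=1}^{k_0-1}a_{2k}+\sum_{k=k_0}^{\lfloor s/2\rfloor}b_{2k}+\mathbf 1_{\alpha<\beta}.$$ Case 2: if $d>\max(a,b)$, then $$\mathrm{PF}\left(\tfrac{\langle a,b\rangle}{d}\right)=\mathcal F_2,\qquad t\left(\tfrac{\langle a,b\rangle}{d}\right)=\sum_{k=k_0}^{\lfloor s/2\rfloor}b_{2k}.$$ -/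

import Mathlib

/-- The submonoid `⟨a, b⟩` of `(ℕ, +)` generated by `a` and `b`. -/
def genTwo (a b : ℕ) : AddSubmonoid ℕ := AddSubmonoid.closure {a, b}

/-- The quotient `S / d = {x ∈ ℕ | d x ∈ S}`. -/
def semigroupQuotient (S : AddSubmonoid ℕ) (d : ℕ) : AddSubmonoid ℕ :=
  S.comap (AddMonoidHom.mulLeft d)

/-- The submonoid `S` of `ℕ`, seen as a subset of `ℤ`. -/
def intCarrier (S : AddSubmonoid ℕ) : Set ℤ := {x | ∃ s ∈ S, (s : ℤ) = x}

/-- The order on `ℤ` induced by `S`: `x ≤_S y` if and only if `y - x ∈ S`. -/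
def semigroupLE (S : AddSubmonoid ℕ) (x y : ℤ) : Prop := y - x ∈ intCarrier S

/-- The pseudo-Frobenius numbers of `S`: the maximal elements of `ℤ \ S` for `≤_S`. -/
def pseudoFrobenius (S : AddSubmonoid ℕ) : Set ℤ :=
  {x | x ∉ intCarrier S ∧ ∀ y, y ∉ intCarrier S → semigroupLE S x y → y = x}

/-- The type of `S`: the cardinality of the set of its pseudo-Frobenius numbers. -/
noncomputable def semigroupType (S : AddSubmonoid ℕ) : ℕ∞ := (pseudoFrobenius S).encard

/-- The finite continued fraction `[x₀, x₁, …, xₙ] = x₀ + 1 / [x₁, …, xₙ]`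
(the value at the empty list is never used). -/
def cfBracket : List ℕ → ℚ
  | [] => 0
  | [x] => x
  | x :: y :: l => x + 1 / cfBracket (y :: l)

/-- `[0, c 1, …, c r, 1]` is the continued fraction expansion of `α` that ends with `1`,
its partial quotients `c 1, …, c r` being positive. -/
def IsCFE (α : ℚ) (r : ℕ) (c : ℕ → ℕ) : Prop :=
  c 0 = 0 ∧ (∀ i ∈ Finset.Icc 1 r, 0 < c i) ∧
    α = cfBracket ((List.range (r + 1)).map c ++ [1])

/-- The numerator `p k` of the convergent `p k / q k = [c 0, …, c k]`. -/
def convNum (c : ℕ → ℕ) : ℕ → ℕ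
  | 0 => c 0
  | 1 => c 1 * c 0 + 1
  | k + 2 => c (k + 2) * convNum c (k + 1) + convNum c k

/-- The denominator `q k` of the convergent `p k / q k = [c 0, …, c k]`. -/
def convDen (c : ℕ → ℕ) : ℕ → ℕ
  | 0 => 1
  | 1 => c 1
  | k + 2 => c (k + 2) * convDen c (k + 1) + convDen c k

/-- `(e 1, …, e r)` is admissible for the partial quotients `c 1, …, c r`:
`0 ≤ e j ≤ c j`, and `e j = 0` only if either all later digits vanish or `e (j-1) = c (j-1)`;
for `j = 1` only the first alternative is possible. -/
def IsAdmissible (r : ℕ) (c e : ℕ → ℕ) : Prop :=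
  ∀ j ∈ Finset.Icc 1 r, e j ≤ c j ∧
    (e j = 0 → (∀ i ∈ Finset.Icc j r, e i = 0) ∨ (2 ≤ j ∧ e (j - 1) = c (j - 1)))

/-- `(e 1, …, e s)`, with `s ≤ r` and `e s > 0`, is (without its tail of zeros) the
`α`-numeration of `β`, where `[0, c 1, …, c r, 1]` is the continued fraction expansion of `α`:
the admissible sequence with `β = ∑ j, e j * (q (j-1) * α - p (j-1))`. -/
def IsNumeration (α : ℚ) (r : ℕ) (c : ℕ → ℕ) (β : ℚ) (s : ℕ) (e : ℕ → ℕ) : Prop :=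
  IsAdmissible r c e ∧
    β = ∑ j ∈ Finset.Icc 1 r,
      (e j : ℚ) * ((convDen c (j - 1) : ℚ) * α - (convNum c (j - 1) : ℚ)) ∧
    s ∈ Finset.Icc 1 r ∧ 0 < e s ∧ ∀ i ∈ Finset.Icc (s + 1) r, e i = 0

/-- `μ i = τ * q i - a * p i`. -/
def muSeq (a : ℕ) (τ : ℤ) (c : ℕ → ℕ) (i : ℕ) : ℤ :=
  τ * (convDen c i : ℤ) - (a : ℤ) * (convNum c i : ℤ)

/-- `B = {i ∈ {1, …, ⌊s/2⌋} | e (2 i) ≠ 0}`. -/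
def evenSupport (s : ℕ) (e : ℕ → ℕ) : Finset ℕ :=
  (Finset.Icc 1 (s / 2)).filter fun i => e (2 * i) ≠ 0

/-- `k₀ = min B` if `B` is not empty, and `k₀ = (s + 1) / 2` otherwise. -/
def kZero (s : ℕ) (e : ℕ → ℕ) : ℕ :=
  if h : (evenSupport s e).Nonempty then (evenSupport s e).min' h else (s + 1) / 2

/-- The set `F₀`. -/
def setF0 (a b d : ℕ) (τ : ℤ) (α β : ℚ) : Set ℤ :=
  {x | α < β ∧ x = (a : ℤ) * ⌊(b : ℚ) / d⌋ - τ}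

/-- The set `F₁`. -/
def setF1 (a b d : ℕ) (τ : ℤ) (c : ℕ → ℕ) (s : ℕ) (e : ℕ → ℕ) : Set ℤ :=
  {x | ∃ k ∈ Finset.Icc 1 (kZero s e - 1), ∃ j ∈ Finset.Icc 1 (c (2 * k)),
    x = (a : ℤ) * ⌊(b : ℚ) / d⌋ - muSeq a τ c (2 * k - 2) - (j : ℤ) * muSeq a τ c (2 * k - 1)}

/-- The set `F₂`; the condition `0 ≤ j ≤ e (2 k) - 1` is written `j < e (2 k)`. -/
def setF2 (a b d : ℕ) (τ : ℤ) (c : ℕ → ℕ) (s : ℕ) (e : ℕ → ℕ) : Set ℤ :=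
  {x | ∃ k ∈ evenSupport s e, ∃ j < e (2 * k),
    x = (a : ℤ) * ⌊(b : ℚ) / d⌋ + a - (j : ℤ) * muSeq a τ c (2 * k - 1)
      - ∑ i ∈ Finset.Icc 1 (2 * k - 1), (e i : ℤ) * muSeq a τ c (i - 1)}

/-- The denominators `q (n - 1)` of the convergents, starting with `q (-1) = 0`. -/
def shiftDen (c : ℕ → ℕ) : ℕ → ℤ
  | 0 => 0
  | 1 => 1
  | n + 2 => c (n + 1) * shiftDen c (n + 1) + shiftDen c n

/-- The numerators `p (n - 1)` of the convergents, starting with `p (-1) = 1`. -/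
def shiftNum (c : ℕ → ℕ) : ℕ → ℤ
  | 0 => 1
  | 1 => 0
  | n + 2 => c (n + 1) * shiftNum c (n + 1) + shiftNum c n

/-- The remainders of the Euclidean algorithm run with the quotients `c i` on `d` and `m`. -/
def euclidRem (d m : ℤ) (c : ℕ → ℕ) : ℕ → ℤ
  | 0 => d
  | 1 => m
  | n + 2 => euclidRem d m c n - c (n + 1) * euclidRem d m c (n + 1)

/-- The partial sums `∑ i ≤ n, e i * q (i - 1)`. -/
def digitDen (c e : ℕ → ℕ) : ℕ → ℤ
  | 0 => 0
  | n + 1 => digitDen c e n + e (n + 1) * shiftDen c (n + 1)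

/-- The partial sums `∑ i ≤ n, e i * p (i - 1)`. -/
def digitNum (c e : ℕ → ℕ) : ℕ → ℤ
  | 0 => 0
  | n + 1 => digitNum c e n + e (n + 1) * shiftNum c (n + 1)

/-- The remainders `(-1) ^ n * (B - ∑ i ≤ n, e i * (q (i - 1) * m - p (i - 1) * d))`. -/
def digitRem (d m B : ℤ) (c e : ℕ → ℕ) : ℕ → ℤ
  | 0 => B
  | n + 1 => e (n + 1) * euclidRem d m c (n + 1) - digitRem d m B c e n

section Convergents

variable (d m B : ℤ) (c e : ℕ → ℕ)

theorem euclidRem_even_odd (l : ℕ) :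
    shiftNum c (2 * l) * d - shiftDen c (2 * l) * m = euclidRem d m c (2 * l) ∧
    shiftDen c (2 * l + 1) * m - shiftNum c (2 * l + 1) * d = euclidRem d m c (2 * l + 1) := by
  induction l with
  | zero => simp [shiftNum, shiftDen, euclidRem]
  | succ l ih =>
    obtain ⟨h₁, h₂⟩ := ih
    have h₃ : shiftNum c (2 * l + 2) * d - shiftDen c (2 * l + 2) * m
        = euclidRem d m c (2 * l + 2) := by
      simp only [shiftNum, shiftDen, euclidRem]
      linear_combination h₁ - (c (2 * l + 1) : ℤ) * h₂
    refine ⟨h₃, ?_⟩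
    show shiftDen c (2 * l + 1 + 2) * m - shiftNum c (2 * l + 1 + 2) * d
      = euclidRem d m c (2 * l + 1 + 2)
    simp only [shiftNum, shiftDen, euclidRem] at h₃ ⊢
    linear_combination h₂ - (c (2 * l + 2) : ℤ) * h₃

theorem euclidRem_even (l : ℕ) :
    shiftNum c (2 * l) * d - shiftDen c (2 * l) * m = euclidRem d m c (2 * l) :=
  (euclidRem_even_odd d m c l).1

theorem euclidRem_odd (l : ℕ) :
    shiftDen c (2 * l + 1) * m - shiftNum c (2 * l + 1) * d = euclidRem d m c (2 * l + 1) :=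
  (euclidRem_even_odd d m c l).2

theorem shiftDet_even_odd (l : ℕ) :
    shiftDen c (2 * l) * shiftNum c (2 * l + 1) - shiftDen c (2 * l + 1) * shiftNum c (2 * l) = -1 ∧
    shiftDen c (2 * l + 1) * shiftNum c (2 * l + 2) - shiftDen c (2 * l + 2) * shiftNum c (2 * l + 1)
      = 1 := by
  induction l with
  | zero => simp [shiftNum, shiftDen]
  | succ l ih =>
    obtain ⟨-, h₂⟩ := ih
    have h₃ : shiftDen c (2 * l + 2) * shiftNum c (2 * l + 1 + 2)
        - shiftDen c (2 * l + 1 + 2) * shiftNum c (2 * l + 2) = -1 := by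
      rw [show shiftNum c (2 * l + 1 + 2)
          = c (2 * l + 2) * shiftNum c (2 * l + 2) + shiftNum c (2 * l + 1) from rfl,
        show shiftDen c (2 * l + 1 + 2)
          = c (2 * l + 2) * shiftDen c (2 * l + 2) + shiftDen c (2 * l + 1) from rfl]
      linear_combination -h₂
    refine ⟨h₃, ?_⟩
    show shiftDen c (2 * l + 1 + 2) * shiftNum c (2 * l + 2 + 2)
        - shiftDen c (2 * l + 2 + 2) * shiftNum c (2 * l + 1 + 2) = 1
    rw [show shiftNum c (2 * l + 2 + 2)
          = c (2 * l + 3) * shiftNum c (2 * l + 1 + 2) + shiftNum c (2 * l + 2) from rfl,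
        show shiftDen c (2 * l + 2 + 2)
          = c (2 * l + 3) * shiftDen c (2 * l + 1 + 2) + shiftDen c (2 * l + 2) from rfl]
    linear_combination -h₃

theorem shiftDen_nonneg : ∀ n, 0 ≤ shiftDen c n
  | 0 => le_rfl
  | 1 => by simp [shiftDen]
  | n + 2 => by
    have h₁ := shiftDen_nonneg (n + 1)
    have h₂ := shiftDen_nonneg n
    simp only [shiftDen]
    positivity

theorem shiftDen_pos {s : ℕ} (hc : ∀ i, 1 ≤ i → i ≤ s → 0 < c i) :
    ∀ n, n ≤ s → 0 < shiftDen c (n + 1)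
  | 0, _ => by simp [shiftDen]
  | n + 1, hn => by
    have h₁ := shiftDen_pos hc n (by omega)
    have h₂ := shiftDen_nonneg c n
    have h₃ : (0 : ℤ) < c (n + 1) := by exact_mod_cast hc (n + 1) (by omega) hn
    simp only [shiftDen]
    positivity

theorem digitRem_even_odd (l : ℕ) :
    digitDen c e (2 * l) * m - digitNum c e (2 * l) * d - B = -digitRem d m B c e (2 * l) ∧
    digitDen c e (2 * l + 1) * m - digitNum c e (2 * l + 1) * d - B
      = digitRem d m B c e (2 * l + 1) := by
  induction l with
  | zero => simp [digitDen, digitNum, digitRem, shiftDen, shiftNum, euclidRem]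
  | succ l ih =>
    have h₁ : digitDen c e (2 * l + 1 + 1) * m - digitNum c e (2 * l + 1 + 1) * d - B
        = -digitRem d m B c e (2 * l + 1 + 1) := by
      have h := euclidRem_even d m c (l + 1)
      rw [show 2 * (l + 1) = 2 * l + 1 + 1 by ring] at h
      simp only [digitDen, digitNum, digitRem] at ih ⊢
      linear_combination ih.2 - (e (2 * l + 1 + 1) : ℤ) * h
    refine ⟨h₁, ?_⟩
    have h := euclidRem_odd d m c (l + 1)
    have h₁ : digitDen c e (2 * (l + 1)) * m - digitNum c e (2 * (l + 1)) * d - B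
        = -digitRem d m B c e (2 * (l + 1)) := h₁
    rw [show digitDen c e (2 * (l + 1) + 1) = digitDen c e (2 * (l + 1))
        + e (2 * (l + 1) + 1) * shiftDen c (2 * (l + 1) + 1) from rfl,
      show digitNum c e (2 * (l + 1) + 1) = digitNum c e (2 * (l + 1))
        + e (2 * (l + 1) + 1) * shiftNum c (2 * (l + 1) + 1) from rfl,
      show digitRem d m B c e (2 * (l + 1) + 1) = e (2 * (l + 1) + 1)
        * euclidRem d m c (2 * (l + 1) + 1) - digitRem d m B c e (2 * (l + 1)) from rfl]
    linear_combination h₁ + (e (2 * (l + 1) + 1) : ℤ) * h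

theorem digitRem_base_form (l : ℕ) :
    (digitDen c e (2 * l) - shiftDen c (2 * l)) * m - (digitNum c e (2 * l) - shiftNum c (2 * l)) * d
      - B = euclidRem d m c (2 * l) - digitRem d m B c e (2 * l) := by
  linear_combination (digitRem_even_odd d m B c e l).1 + euclidRem_even d m c l

theorem digitRem_digit_form (l j : ℕ) :
    (digitDen c e (2 * l + 1) + j * shiftDen c (2 * l + 2)) * m
      - (digitNum c e (2 * l + 1) + j * shiftNum c (2 * l + 2)) * d - B
      = digitRem d m B c e (2 * l + 1) - j * euclidRem d m c (2 * l + 2) := by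
  linear_combination (digitRem_even_odd d m B c e l).2 - (j : ℤ) * euclidRem_even d m c (l + 1)

theorem digitDen_mono {n k : ℕ} (h : n ≤ k) : digitDen c e n ≤ digitDen c e k := by
  induction k, h using Nat.le_induction with
  | base => exact le_rfl
  | succ k _ ih =>
    have := shiftDen_nonneg c (k + 1)
    have : (0 : ℤ) ≤ e (k + 1) * shiftDen c (k + 1) := by positivity
    simp only [digitDen]
    linarith

end Convergents

/-- If `(x₁, y₁), (x₂, y₂)` is a basis of `ℤ²` on which the linear form `(x, y) ↦ x * A + y * C` takes
a positive and a nonpositive value, then among the vectors with first coordinate in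
`(0, x₁ + x₂)` where the form is positive, it is at least its value at `(x₁, y₁)`. -/
theorem le_form_of_basis {x₁ y₁ x₂ y₂ σ A C x y : ℤ} (hσ : σ * σ = 1)
    (hdet : x₁ * y₂ - x₂ * y₁ = σ) (hx₁ : 0 ≤ x₁) (hx₂ : 0 ≤ x₂)
    (h₁ : 0 < x₁ * A + y₁ * C) (h₂ : x₂ * A + y₂ * C ≤ 0)
    (hx : 0 < x) (hx' : x < x₁ + x₂) (hpos : 0 < x * A + y * C) :
    x₁ * A + y₁ * C ≤ x * A + y * C := by
  set s := σ * (x * y₂ - x₂ * y) with hs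
  set t := σ * (x₁ * y - x * y₁) with ht
  have hxs : x = s * x₁ + t * x₂ := by
    rw [hs, ht]; linear_combination (-x) * hσ - σ * x * hdet
  have hys : y = s * y₁ + t * y₂ := by
    rw [hs, ht]; linear_combination (-y) * hσ - σ * y * hdet
  have hf : x * A + y * C = s * (x₁ * A + y₁ * C) + t * (x₂ * A + y₂ * C) := by
    linear_combination A * hxs + C * hys
  rcases lt_or_ge 0 s with h | h
  · rcases lt_or_ge 0 t with h' | h'
    · nlinarith
    · nlinarith [mul_nonneg_of_nonpos_of_nonpos h' h₂]
  · have : t < 0 := by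
      by_contra! h'
      nlinarith [mul_nonneg (neg_nonneg.2 h) h₁.le, mul_nonneg h' (neg_nonneg.2 h₂)]
    nlinarith [mul_nonneg (neg_nonneg.2 h) hx₁, mul_nonneg (neg_nonneg.2 this.le) hx₂]

/-- Best approximation from above by the intermediate convergents. -/
theorem upper_approx {d m : ℤ} {c : ℕ → ℕ} {l j : ℕ} {x y : ℤ}
    (hD : 0 ≤ euclidRem d m c (2 * l + 1))
    (hj : 0 < euclidRem d m c (2 * l) - j * euclidRem d m c (2 * l + 1))
    (hx : 0 < x) (hx' : x < shiftDen c (2 * l) + (j + 1) * shiftDen c (2 * l + 1))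
    (hpos : 0 < y * d - x * m) :
    euclidRem d m c (2 * l) - j * euclidRem d m c (2 * l + 1) ≤ y * d - x * m := by
  have h₁ := euclidRem_even d m c l
  have h₂ := euclidRem_odd d m c l
  have h₃ := (shiftDet_even_odd c l).1
  have q₁ := shiftDen_nonneg c (2 * l)
  have q₂ := shiftDen_nonneg c (2 * l + 1)
  have hV : (shiftDen c (2 * l) + j * shiftDen c (2 * l + 1)) * -m
      + (shiftNum c (2 * l) + j * shiftNum c (2 * l + 1)) * d
      = euclidRem d m c (2 * l) - j * euclidRem d m c (2 * l + 1) := by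
    linear_combination h₁ - (j : ℤ) * h₂
  have key := le_form_of_basis (x₁ := shiftDen c (2 * l) + j * shiftDen c (2 * l + 1))
    (y₁ := shiftNum c (2 * l) + j * shiftNum c (2 * l + 1)) (x₂ := shiftDen c (2 * l + 1))
    (y₂ := shiftNum c (2 * l + 1)) (σ := -1) (A := -m) (C := d) (x := x) (y := y)
    (by norm_num) (by linear_combination h₃) (by positivity) q₂ (by linarith [hV]) (by linarith)
    hx (by linarith) (by linarith)
  linarith

/-- Best approximation from below by the intermediate convergents. -/
theorem lower_approx {d m : ℤ} {c : ℕ → ℕ} {l j : ℕ} {x y : ℤ}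
    (hD : 0 ≤ euclidRem d m c (2 * l + 2))
    (hj : 0 < euclidRem d m c (2 * l + 1) - j * euclidRem d m c (2 * l + 2))
    (hx : 0 < x) (hx' : x < shiftDen c (2 * l + 1) + (j + 1) * shiftDen c (2 * l + 2))
    (hpos : 0 < x * m - y * d) :
    euclidRem d m c (2 * l + 1) - j * euclidRem d m c (2 * l + 2) ≤ x * m - y * d := by
  have h₁ : shiftNum c (2 * l + 2) * d - shiftDen c (2 * l + 2) * m
      = euclidRem d m c (2 * l + 2) := euclidRem_even d m c (l + 1)
  have h₂ := euclidRem_odd d m c l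
  have h₃ := (shiftDet_even_odd c l).2
  have q₁ := shiftDen_nonneg c (2 * l + 1)
  have q₂ := shiftDen_nonneg c (2 * l + 2)
  have hV : (shiftDen c (2 * l + 1) + j * shiftDen c (2 * l + 2)) * m
      + (shiftNum c (2 * l + 1) + j * shiftNum c (2 * l + 2)) * -d
      = euclidRem d m c (2 * l + 1) - j * euclidRem d m c (2 * l + 2) := by
    linear_combination h₂ - (j : ℤ) * h₁
  have key := le_form_of_basis (x₁ := shiftDen c (2 * l + 1) + j * shiftDen c (2 * l + 2))
    (y₁ := shiftNum c (2 * l + 1) + j * shiftNum c (2 * l + 2)) (x₂ := shiftDen c (2 * l + 2))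
    (y₂ := shiftNum c (2 * l + 2)) (σ := 1) (A := m) (C := -d) (x := x) (y := y)
    (by norm_num) (by linear_combination h₃) (by positivity) q₂ (by linarith [hV]) (by linarith)
    hx (by linarith) (by linarith)
  linarith

/-- Digits `e 1, …, e s` of `B` with respect to the Euclidean algorithm on `d` and `m`. -/
structure IsDigitExpansion (d m B : ℤ) (s : ℕ) (c e : ℕ → ℕ) : Prop where
  rem_pos : ∀ n ≤ s + 1, 0 < euclidRem d m c n
  quot_pos : ∀ i, 1 ≤ i → i ≤ s → 0 < c i
  digit_le : ∀ i, 1 ≤ i → i ≤ s → e i ≤ c i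
  prev_full : ∀ i, 1 ≤ i → i ≤ s → e i = 0 → 2 ≤ i ∧ e (i - 1) = c (i - 1)
  one_le : 1 ≤ s
  last_pos : 0 < e s
  rem_eq_zero : digitRem d m B c e s = 0

/-- `(u, h)` realizes a strict record minimum of `u * m - h * d - B` among its positive values,
the records being taken over `u ≥ lo`. -/
def IsRecord (d m B lo u h : ℤ) : Prop :=
  lo ≤ u ∧ 0 < u * m - h * d - B ∧ ∀ u' h' : ℤ, lo ≤ u' → u' ≤ u → 0 < u' * m - h' * d - B →
    (u' = u ∧ h' = h) ∨ u * m - h * d - B < u' * m - h' * d - B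

namespace IsRecord

variable {d m B U h x y : ℤ}

theorem unique_of_gap (hU : IsRecord d m B 0 U h)
    (gap : ∀ x' y' : ℤ, 0 < x' → x' < x → 0 < y' * d - x' * m → U * m - h * d - B ≤ y' * d - x' * m)
    {u' h' : ℤ} (hr : IsRecord d m B 0 u' h') (h₁ : U ≤ u') (h₂ : u' < U + x) :
    u' = U ∧ h' = h := by
  rcases hr.2.2 U h hU.1 h₁ hU.2.1 with ⟨e₁, e₂⟩ | hlt
  · exact ⟨e₁.symm, e₂.symm⟩
  · rcases h₁.eq_or_lt with rfl | h₁
    · rcases hU.2.2 U h' hU.1 le_rfl hr.2.1 with h₃ | h₃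
      · exact h₃
      · linarith
    · have := gap (u' - U) (h' - h) (by linarith) (by linarith) (by linarith)
      linarith [hr.2.1]

theorem num_unique {h' : ℤ} (hU : IsRecord d m B 0 U h) (hU' : IsRecord d m B 0 U h') :
    h' = h := by
  rcases hU.2.2 U h' hU.1 le_rfl hU'.2.1 with h₁ | h₁
  · exact h₁.2
  · rcases hU'.2.2 U h hU.1 le_rfl hU.2.1 with h₂ | h₂
    · exact h₂.2.symm
    · linarith

theorem le_or_eq_of_gap (hU : IsRecord d m B 0 U h)
    (gap : ∀ x' y' : ℤ, 0 < x' → x' < x → 0 < y' * d - x' * m → U * m - h * d - B ≤ y' * d - x' * m)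
    (hUx : IsRecord d m B 0 (U + x) (h + y)) {u' h' : ℤ} (hr : IsRecord d m B 0 u' h')
    (hle : u' ≤ U + x) : u' ≤ U ∨ (u' = U + x ∧ h' = h + y) := by
  rcases hle.eq_or_lt with rfl | hlt
  · exact Or.inr ⟨rfl, hUx.num_unique hr⟩
  · refine Or.inl ?_
    by_contra! h₁
    exact h₁.ne' (hU.unique_of_gap gap hr h₁.le hlt).1

theorem origin (hd : 0 < d) (hB : 0 ≤ B) (hBd : B < d) : IsRecord d m B 0 0 (-1) := by
  refine ⟨le_rfl, by linarith, fun u' h' h₁ h₂ h₃ => ?_⟩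
  obtain rfl : u' = 0 := le_antisymm h₂ h₁
  rcases lt_trichotomy h' (-1) with h₄ | h₄ | h₄
  · right; nlinarith
  · exact Or.inl ⟨rfl, h₄⟩
  · exfalso; nlinarith

theorem step (hd : 0 < d) (hB : 0 ≤ B) (hBd : B < d) (hU : IsRecord d m B 0 U h) (hx : 0 < x)
    (gap : ∀ x' y' : ℤ, 0 < x' → x' < x → 0 < y' * d - x' * m → U * m - h * d - B ≤ y' * d - x' * m)
    (hxy : 0 < y * d - x * m) (hpos : 0 < (U + x) * m - (h + y) * d - B) :
    IsRecord d m B 0 (U + x) (h + y) := by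
  have hU0 := hU.1
  have hU1 := hU.2.1
  refine ⟨by linarith, hpos, fun u' h' hu' hle hp => ?_⟩
  rcases le_or_gt u' U with h₁ | h₁
  · right
    rcases hU.2.2 u' h' hu' h₁ hp with ⟨rfl, rfl⟩ | h₂ <;> linarith
  · rcases hle.eq_or_lt with rfl | h₂
    · rcases lt_trichotomy h' (h + y) with h₃ | h₃ | h₃
      · right; nlinarith
      · exact Or.inl ⟨rfl, h₃⟩
      · exfalso
        have hle : U * m - h * d - B ≤ d := by
          rcases hU.2.2 0 (-1) le_rfl hU0 (by linarith) with ⟨rfl, rfl⟩ | h₂ <;> linarith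
        nlinarith
    · right
      by_contra! h₃
      have := gap (u' - U) (h' - h) (by linarith) (by linarith) (by linarith)
      linarith

end IsRecord

namespace IsDigitExpansion

variable {d m B : ℤ} {s : ℕ} {c e : ℕ → ℕ}

theorem digitRem_bounds (E : IsDigitExpansion d m B s c e) {n : ℕ} (hn : n ≤ s) :
    -euclidRem d m c (n + 1) < digitRem d m B c e n ∧ digitRem d m B c e n < euclidRem d m c n := by
  induction hn using Nat.decreasingInduction with
  | self => rw [E.rem_eq_zero]; exact ⟨by linarith [E.rem_pos (s + 1) le_rfl], E.rem_pos s (by omega)⟩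
  | of_succ n hn ih =>
    have h₁ : digitRem d m B c e (n + 1)
        = e (n + 1) * euclidRem d m c (n + 1) - digitRem d m B c e n := rfl
    have h₂ : euclidRem d m c (n + 2)
        = euclidRem d m c n - c (n + 1) * euclidRem d m c (n + 1) := rfl
    have h₃ := E.rem_pos (n + 1) (by omega)
    have h₄ : (e (n + 1) : ℤ) ≤ c (n + 1) := by exact_mod_cast E.digit_le (n + 1) (by omega) hn
    have h₅ : (0 : ℤ) ≤ e (n + 1) := by positivity
    constructor <;> nlinarith

theorem shiftDen_pos (E : IsDigitExpansion d m B s c e)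
    {n : ℕ} (hn : n ≤ s) : 0 < shiftDen c (n + 1) :=
  _root_.shiftDen_pos c E.quot_pos n hn

theorem euclidRem_add_two_le (E : IsDigitExpansion d m B s c e) {n : ℕ} (hn : n + 1 ≤ s) :
    euclidRem d m c (n + 2) ≤ euclidRem d m c n := by
  have h₁ := E.rem_pos (n + 1) (by omega)
  have : (0 : ℤ) ≤ c (n + 1) * euclidRem d m c (n + 1) := by positivity
  simp only [euclidRem]
  linarith

theorem gap_full (E : IsDigitExpansion d m B s c e)
    {l : ℕ} (hl : 2 * l + 1 ≤ s) {x y : ℤ} (hx : 0 < x)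
    (hx' : x < shiftDen c (2 * l + 2)) (hpos : 0 < y * d - x * m) :
    euclidRem d m c (2 * l + 2) + euclidRem d m c (2 * l + 1) ≤ y * d - x * m := by
  have hc := E.quot_pos (2 * l + 1) (by omega) hl
  have h₁ := E.rem_pos (2 * l + 1) (by omega)
  have h₂ := E.rem_pos (2 * l + 2) (by omega)
  have h₃ : euclidRem d m c (2 * l + 2)
    = euclidRem d m c (2 * l) - c (2 * l + 1) * euclidRem d m c (2 * l + 1) := rfl
  have h₄ : shiftDen c (2 * l + 2)
    = c (2 * l + 1) * shiftDen c (2 * l + 1) + shiftDen c (2 * l) := rfl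
  obtain ⟨j, hj⟩ : ∃ j, c (2 * l + 1) = j + 1 := ⟨c (2 * l + 1) - 1, by omega⟩
  rw [hj] at h₃ h₄
  push_cast at h₃ h₄
  have := upper_approx (d := d) (m := m) (c := c) (l := l) (j := j) h₁.le (by linarith) hx
    (by linarith) hpos
  linarith

theorem gap_jump (E : IsDigitExpansion d m B s c e)
    {l : ℕ} (hl : 2 * l + 1 ≤ s + 1) (hl' : 2 * l + 1 = s + 1 → e (2 * l + 1) = 0)
    {x y : ℤ} (hx : 0 < x)
    (hx' : x < shiftDen c (2 * l) + e (2 * l + 1) * shiftDen c (2 * l + 1))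
    (hpos : 0 < y * d - x * m) :
    euclidRem d m c (2 * l) - digitRem d m B c e (2 * l) ≤ y * d - x * m := by
  rcases Nat.eq_zero_or_pos (e (2 * l + 1)) with h0 | h0
  · obtain ⟨k, rfl⟩ : ∃ k, l = k + 1 := by
      refine ⟨l - 1, ?_⟩
      rcases eq_or_lt_of_le hl with h | h
      · have := E.one_le
        omega
      · have := (E.prev_full (2 * l + 1) (by omega) (by omega) h0).1
        omega
    rw [h0, Nat.cast_zero, zero_mul, add_zero] at hx'
    have h₁ := E.gap_full (l := k) (by omega) hx hx' hpos
    have h₂ := (E.digitRem_bounds (n := 2 * (k + 1)) (by omega)).1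
    have h₃ := E.euclidRem_add_two_le (n := 2 * k + 1) (by omega)
    rw [show 2 * (k + 1) = 2 * k + 2 by ring] at h₂ ⊢
    rw [show 2 * k + 2 + 1 = 2 * k + 1 + 2 by ring] at h₂
    linarith
  · have hs : 2 * l + 1 ≤ s := by
      by_contra h
      have := hl' (by omega)
      omega
    obtain ⟨j, hj⟩ : ∃ j, e (2 * l + 1) = j + 1 := ⟨e (2 * l + 1) - 1, by omega⟩
    have h₁ := E.rem_pos (2 * l + 1) (by omega)
    have h₂ := (E.digitRem_bounds (n := 2 * l) (by omega)).2
    have h₃ := (E.digitRem_bounds hs).2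
    have h₄ : digitRem d m B c e (2 * l + 1)
        = e (2 * l + 1) * euclidRem d m c (2 * l + 1) - digitRem d m B c e (2 * l) := rfl
    rw [hj] at hx' h₄
    push_cast at hx' h₄
    have := upper_approx (d := d) (m := m) (c := c) (l := l) (j := j) h₁.le (by linarith) hx
      (by linarith) hpos
    linarith

/-- The records obtained from a nonzero even digit. -/
theorem records_digit (E : IsDigitExpansion d m B s c e)
    (hd : 0 < d) (hB : 0 ≤ B) (hBd : B < d) {l : ℕ} (hl : 2 * l + 2 ≤ s)
    (hr : IsRecord d m B 0 (digitDen c e (2 * l) - shiftDen c (2 * l))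
      (digitNum c e (2 * l) - shiftNum c (2 * l))) {j : ℕ} (hj : j < e (2 * l + 2)) :
    IsRecord d m B 0 (digitDen c e (2 * l + 1) + j * shiftDen c (2 * l + 2))
      (digitNum c e (2 * l + 1) + j * shiftNum c (2 * l + 2)) ∧
    ∀ u h, IsRecord d m B 0 u h → u ≤ digitDen c e (2 * l + 1) + j * shiftDen c (2 * l + 2) →
      u ≤ digitDen c e (2 * l) - shiftDen c (2 * l) ∨
      ∃ i ≤ j, u = digitDen c e (2 * l + 1) + i * shiftDen c (2 * l + 2) ∧
        h = digitNum c e (2 * l + 1) + i * shiftNum c (2 * l + 2) := by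
  have hT := (E.digitRem_bounds (n := 2 * l + 2) (by omega)).2
  have hT' : digitRem d m B c e (2 * l + 2) = e (2 * l + 2) * euclidRem d m c (2 * l + 2)
    - digitRem d m B c e (2 * l + 1) := rfl
  have hD := E.rem_pos (2 * l + 2) (by omega)
  have hpos : ∀ i : ℕ, i < e (2 * l + 2) →
      0 < digitRem d m B c e (2 * l + 1) - i * euclidRem d m c (2 * l + 2) := by
    intro i hi
    have : (i : ℤ) + 1 ≤ e (2 * l + 2) := by exact_mod_cast hi
    nlinarith
  induction j with
  | zero =>
    have hx : 0 < shiftDen c (2 * l) + e (2 * l + 1) * shiftDen c (2 * l + 1) := by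
      have h₁ := shiftDen_nonneg c (2 * l)
      have h₂ := E.shiftDen_pos (n := 2 * l) (by omega)
      rcases Nat.eq_zero_or_pos (e (2 * l + 1)) with h0 | h0
      · have := (E.prev_full (2 * l + 1) (by omega) (by omega) h0).1
        obtain ⟨k, rfl⟩ : ∃ k, l = k + 1 := ⟨l - 1, by omega⟩
        have h₃ := E.shiftDen_pos (n := 2 * k + 1) (by omega)
        rw [show 2 * (k + 1) = 2 * k + 1 + 1 by ring] at h₂ ⊢
        positivity
      · positivity
    have gap : ∀ x' y' : ℤ, 0 < x' → x' < shiftDen c (2 * l) + e (2 * l + 1) * shiftDen c (2 * l + 1)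
        → 0 < y' * d - x' * m → (digitDen c e (2 * l) - shiftDen c (2 * l)) * m
          - (digitNum c e (2 * l) - shiftNum c (2 * l)) * d - B ≤ y' * d - x' * m := by
      intro x' y' h₁ h₂ h₃
      rw [digitRem_base_form]
      exact E.gap_jump (by omega) (by omega) h₁ h₂ h₃
    have eu : digitDen c e (2 * l + 1) + (0 : ℕ) * shiftDen c (2 * l + 2)
        = digitDen c e (2 * l) - shiftDen c (2 * l)
          + (shiftDen c (2 * l) + e (2 * l + 1) * shiftDen c (2 * l + 1)) := by
      simp only [digitDen]; push_cast; ring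
    have eh : digitNum c e (2 * l + 1) + (0 : ℕ) * shiftNum c (2 * l + 2)
        = digitNum c e (2 * l) - shiftNum c (2 * l)
          + (shiftNum c (2 * l) + e (2 * l + 1) * shiftNum c (2 * l + 1)) := by
      simp only [digitNum]; push_cast; ring
    have hxy : 0 < (shiftNum c (2 * l) + e (2 * l + 1) * shiftNum c (2 * l + 1)) * d
        - (shiftDen c (2 * l) + e (2 * l + 1) * shiftDen c (2 * l + 1)) * m := by
      have h₁ := euclidRem_even d m c l
      have h₂ := euclidRem_odd d m c l
      have h₃ : (shiftNum c (2 * l) + e (2 * l + 1) * shiftNum c (2 * l + 1)) * d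
        - (shiftDen c (2 * l) + e (2 * l + 1) * shiftDen c (2 * l + 1)) * m
        = euclidRem d m c (2 * l) - e (2 * l + 1) * euclidRem d m c (2 * l + 1) := by
        linear_combination h₁ - (e (2 * l + 1) : ℤ) * h₂
      rw [h₃]
      have h₄ : (e (2 * l + 1) : ℤ) ≤ c (2 * l + 1) := by
        exact_mod_cast E.digit_le (2 * l + 1) (by omega) (by omega)
      have h₅ := E.rem_pos (2 * l + 1) (by omega)
      simp only [euclidRem] at hD
      nlinarith
    have hrec : IsRecord d m B 0 (digitDen c e (2 * l + 1) + (0 : ℕ) * shiftDen c (2 * l + 2))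
        (digitNum c e (2 * l + 1) + (0 : ℕ) * shiftNum c (2 * l + 2)) := by
      have hp := hpos 0 hj
      rw [← digitRem_digit_form, eu, eh] at hp
      rw [eu, eh]
      exact hr.step hd hB hBd hx gap hxy hp
    refine ⟨hrec, fun u h hu hle => ?_⟩
    rw [eu, eh] at hrec
    rw [eu] at hle
    rcases hr.le_or_eq_of_gap gap hrec hu hle with h₁ | ⟨h₁, h₂⟩
    · exact Or.inl h₁
    · exact Or.inr ⟨0, le_rfl, h₁.trans eu.symm, h₂.trans eh.symm⟩
  | succ j ih =>
    obtain ⟨hrj, hall⟩ := ih (by omega)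
    have gap : ∀ x' y' : ℤ, 0 < x' → x' < shiftDen c (2 * l + 2)
        → 0 < y' * d - x' * m → (digitDen c e (2 * l + 1) + j * shiftDen c (2 * l + 2)) * m
          - (digitNum c e (2 * l + 1) + j * shiftNum c (2 * l + 2)) * d - B ≤ y' * d - x' * m := by
      intro x' y' h₁ h₂ h₃
      rw [digitRem_digit_form]
      have h₄ := E.gap_full (l := l) (by omega) h₁ h₂ h₃
      have h₅ := (E.digitRem_bounds (n := 2 * l + 1) (by omega)).2
      have h₆ : (0 : ℤ) ≤ j * euclidRem d m c (2 * l + 2) := by positivity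
      linarith
    have eu : digitDen c e (2 * l + 1) + (j + 1 : ℕ) * shiftDen c (2 * l + 2)
        = digitDen c e (2 * l + 1) + j * shiftDen c (2 * l + 2) + shiftDen c (2 * l + 2) := by
      push_cast; ring
    have eh : digitNum c e (2 * l + 1) + (j + 1 : ℕ) * shiftNum c (2 * l + 2)
        = digitNum c e (2 * l + 1) + j * shiftNum c (2 * l + 2) + shiftNum c (2 * l + 2) := by
      push_cast; ring
    have hrec : IsRecord d m B 0 (digitDen c e (2 * l + 1) + (j + 1 : ℕ) * shiftDen c (2 * l + 2))
        (digitNum c e (2 * l + 1) + (j + 1 : ℕ) * shiftNum c (2 * l + 2)) := by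
      have hp := hpos (j + 1) hj
      rw [← digitRem_digit_form, eu, eh] at hp
      rw [eu, eh]
      refine hrj.step hd hB hBd (E.shiftDen_pos (n := 2 * l + 1) (by omega)) gap ?_ hp
      have := euclidRem_even d m c (l + 1)
      rw [show 2 * (l + 1) = 2 * l + 2 by ring] at this
      rw [this]
      exact hD
    refine ⟨hrec, fun u h hu hle => ?_⟩
    rw [eu, eh] at hrec
    rw [eu] at hle
    rcases hrj.le_or_eq_of_gap gap hrec hu hle with h₁ | ⟨h₁, h₂⟩
    · rcases hall u h hu h₁ with h₃ | ⟨i, hi, h₃⟩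
      · exact Or.inl h₃
      · exact Or.inr ⟨i, hi.trans (Nat.le_succ j), h₃⟩
    · exact Or.inr ⟨j + 1, le_rfl, h₁.trans eu.symm, h₂.trans eh.symm⟩

theorem base_succ_of_digit_eq_zero (E : IsDigitExpansion d m B s c e)
    {l : ℕ} (hl : 2 * l + 2 ≤ s) (h0 : e (2 * l + 2) = 0) :
    digitDen c e (2 * l + 2) - shiftDen c (2 * l + 2)
        = digitDen c e (2 * l) - shiftDen c (2 * l) ∧
    digitNum c e (2 * l + 2) - shiftNum c (2 * l + 2)
        = digitNum c e (2 * l) - shiftNum c (2 * l) := by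
  have h₁ : e (2 * l + 1) = c (2 * l + 1) := (E.prev_full (2 * l + 2) (by omega) hl h0).2
  simp only [digitDen, digitNum, shiftDen, shiftNum, h0, h₁]
  constructor <;> push_cast <;> ring

/-- The records up to the base point attached to an even index. -/
theorem records_upto (E : IsDigitExpansion d m B s c e)
    (hd : 0 < d) (hB : 0 ≤ B) (hBd : B < d) {l : ℕ} (hl : 2 * l ≤ s) :
    IsRecord d m B 0 (digitDen c e (2 * l) - shiftDen c (2 * l))
      (digitNum c e (2 * l) - shiftNum c (2 * l)) ∧
    ∀ u h, 0 < u → IsRecord d m B 0 u h → u ≤ digitDen c e (2 * l) - shiftDen c (2 * l) →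
      ∃ k < l, ∃ j < e (2 * k + 2), u = digitDen c e (2 * k + 1) + j * shiftDen c (2 * k + 2) ∧
        h = digitNum c e (2 * k + 1) + j * shiftNum c (2 * k + 2) := by
  induction l with
  | zero =>
    refine ⟨?_, fun u h hu _ hle => ?_⟩
    · simpa [digitDen, digitNum, shiftDen, shiftNum] using IsRecord.origin (m := m) hd hB hBd
    · simp [digitDen, shiftDen] at hle
      omega
  | succ l ih =>
    obtain ⟨hr, hall⟩ := ih (by omega)
    rw [show 2 * (l + 1) = 2 * l + 2 by ring] at hl ⊢
    rcases Nat.eq_zero_or_pos (e (2 * l + 2)) with h0 | h0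
    · rw [(E.base_succ_of_digit_eq_zero hl h0).1, (E.base_succ_of_digit_eq_zero hl h0).2]
      refine ⟨hr, fun u h hu h₁ h₂ => ?_⟩
      obtain ⟨k, hk, h₃⟩ := hall u h hu h₁ h₂
      exact ⟨k, by omega, h₃⟩
    · obtain ⟨j, hj⟩ : ∃ j, e (2 * l + 2) = j + 1 := ⟨e (2 * l + 2) - 1, by omega⟩
      have eu : digitDen c e (2 * l + 2) - shiftDen c (2 * l + 2)
          = digitDen c e (2 * l + 1) + j * shiftDen c (2 * l + 2) := by
        rw [show digitDen c e (2 * l + 2)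
          = digitDen c e (2 * l + 1) + e (2 * l + 2) * shiftDen c (2 * l + 2) from rfl, hj]
        push_cast; ring
      have eh : digitNum c e (2 * l + 2) - shiftNum c (2 * l + 2)
          = digitNum c e (2 * l + 1) + j * shiftNum c (2 * l + 2) := by
        rw [show digitNum c e (2 * l + 2)
          = digitNum c e (2 * l + 1) + e (2 * l + 2) * shiftNum c (2 * l + 2) from rfl, hj]
        push_cast; ring
      obtain ⟨hrj, hallj⟩ := E.records_digit hd hB hBd hl hr (j := j) (by omega)
      rw [eu, eh]
      refine ⟨hrj, fun u h hu h₁ h₂ => ?_⟩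
      rcases hallj u h h₁ h₂ with h₃ | ⟨i, hi, h₃⟩
      · obtain ⟨k, hk, h₄⟩ := hall u h hu h₁ h₃
        exact ⟨k, by omega, h₄⟩
      · exact ⟨l, by omega, i, by omega, h₃⟩

/-- The records before `∑ i ≤ s, e i * q (i - 1)`. -/
theorem record_iff (E : IsDigitExpansion d m B s c e)
    (hd : 0 < d) (hB : 0 ≤ B) (hBd : B < d) {u h : ℤ} (hu : 0 < u) (hus : u < digitDen c e s) :
    IsRecord d m B 0 u h ↔
      ∃ k < s / 2, ∃ j < e (2 * k + 2),
        u = digitDen c e (2 * k + 1) + j * shiftDen c (2 * k + 2) ∧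
        h = digitNum c e (2 * k + 1) + j * shiftNum c (2 * k + 2) := by
  constructor
  · intro hr
    obtain ⟨hr', hall⟩ := E.records_upto hd hB hBd (l := s / 2) (by omega)
    refine hall u h hu hr ?_
    by_contra! hlt
    have key : ∀ x : ℤ, digitDen c e s = digitDen c e (2 * (s / 2)) - shiftDen c (2 * (s / 2)) + x →
        (∀ x' y' : ℤ, 0 < x' → x' < x → 0 < y' * d - x' * m → (digitDen c e (2 * (s / 2))
          - shiftDen c (2 * (s / 2))) * m - (digitNum c e (2 * (s / 2))
          - shiftNum c (2 * (s / 2))) * d - B ≤ y' * d - x' * m) → False := by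
      intro x hx gap
      rw [hx] at hus
      exact hlt.ne' (hr'.unique_of_gap gap hr hlt.le hus).1
    rw [digitRem_base_form] at key
    rcases Nat.even_or_odd' s with ⟨n, hn | hn⟩
    · obtain ⟨k, rfl⟩ : ∃ k, n = k + 1 := ⟨n - 1, by have := E.one_le; omega⟩
      have hs2 : 2 * (s / 2) = s := by omega
      rw [hs2] at key
      refine key (shiftDen c s) (by ring) fun x' y' h₁ h₂ h₃ => ?_
      rw [E.rem_eq_zero, hn]
      rw [hn] at h₂
      have h₄ := E.gap_full (l := k) (by omega) h₁ h₂ h₃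
      have h₅ := E.rem_pos (2 * k + 1) (by omega)
      rw [show 2 * (k + 1) = 2 * k + 2 by ring]
      linarith
    · have hs2 : s / 2 = n := by omega
      rw [hs2] at key
      refine key (shiftDen c (2 * n) + e (2 * n + 1) * shiftDen c (2 * n + 1)) ?_
        fun x' y' h₁ h₂ h₃ => ?_
      · rw [hn]
        simp only [digitDen]; ring
      · exact E.gap_jump (by omega) (by omega) h₁ h₂ h₃
  · rintro ⟨k, hk, j, hj, rfl, rfl⟩
    exact (E.records_digit hd hB hBd (by omega) (E.records_upto hd hB hBd (by omega)).1 hj).1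

end IsDigitExpansion

theorem IsDigitExpansion.form_eq_zero {d m B : ℤ} {s : ℕ} {c e : ℕ → ℕ}
    (E : IsDigitExpansion d m B s c e) :
    digitDen c e s * m - digitNum c e s * d - B = 0 := by
  have h₂ := E.rem_eq_zero
  rcases Nat.even_or_odd' s with ⟨n, rfl | rfl⟩
  · linarith [(digitRem_even_odd d m B c e n).1]
  · linarith [(digitRem_even_odd d m B c e n).2]

namespace IsDigitExpansion

variable {d m B : ℤ} {s : ℕ} {c e : ℕ → ℕ}

theorem rem_intermediate_pos (E : IsDigitExpansion d m B s c e) {l j : ℕ} (hl : 2 * l + 2 ≤ s)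
    (hj : j ≤ c (2 * l + 2)) :
    0 < euclidRem d m c (2 * l + 1) - j * euclidRem d m c (2 * l + 2) := by
  have h₁ := E.rem_pos (2 * l + 1 + 2) (by omega)
  have h₂ := E.rem_pos (2 * l + 2) (by omega)
  have h₃ : (j : ℤ) ≤ c (2 * l + 2) := by exact_mod_cast hj
  have h₄ : euclidRem d m c (2 * l + 1 + 2)
    = euclidRem d m c (2 * l + 1) - c (2 * l + 2) * euclidRem d m c (2 * l + 2) := rfl
  nlinarith

/-- Every positive value of `u * m - y * d` is bounded below by the value at a smaller best
approximation from below. -/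
theorem lower_cover (E : IsDigitExpansion d m B s c e) {l : ℕ} (hl : 2 * l + 1 ≤ s) {u y : ℤ}
    (hu : 0 < u) (hu' : u < shiftDen c (2 * l + 1) + shiftDen c (2 * l + 2))
    (hpos : 0 < u * m - y * d) :
    m ≤ u * m - y * d ∨ ∃ k < l, ∃ j ∈ Finset.Icc 1 (c (2 * k + 2)),
      shiftDen c (2 * k + 1) + j * shiftDen c (2 * k + 2) ≤ u ∧
      euclidRem d m c (2 * k + 1) - j * euclidRem d m c (2 * k + 2) ≤ u * m - y * d := by
  induction l with
  | zero =>
    left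
    have h₁ : euclidRem d m c 1 = m := rfl
    have := lower_approx (d := d) (m := m) (c := c) (l := 0) (j := 0) (x := u) (y := y)
      (E.rem_pos 2 (by omega)).le (by simpa [h₁] using E.rem_pos 1 (by omega)) hu
      (by simpa using hu') hpos
    simpa [h₁] using this
  | succ l ih =>
    have hD : euclidRem d m c (2 * l + 3)
      = euclidRem d m c (2 * l + 1) - c (2 * l + 2) * euclidRem d m c (2 * l + 2) := rfl
    have hQ : shiftDen c (2 * l + 3)
      = c (2 * l + 2) * shiftDen c (2 * l + 2) + shiftDen c (2 * l + 1) := rfl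
    have hc := E.quot_pos (2 * l + 2) (by omega) (by omega)
    have step : ∀ j : ℕ, j < c (2 * l + 2) →
        u < shiftDen c (2 * l + 1) + (j + 1) * shiftDen c (2 * l + 2) →
        m ≤ u * m - y * d ∨ ∃ k < l + 1, ∃ j ∈ Finset.Icc 1 (c (2 * k + 2)),
          shiftDen c (2 * k + 1) + j * shiftDen c (2 * k + 2) ≤ u ∧
          euclidRem d m c (2 * k + 1) - j * euclidRem d m c (2 * k + 2) ≤ u * m - y * d := by
      intro j
      induction j with
      | zero =>
        intro _ h
        rcases ih (by omega) (by simpa using h) with h₁ | ⟨k, hk, h₁⟩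
        · exact Or.inl h₁
        · exact Or.inr ⟨k, by omega, h₁⟩
      | succ j ihj =>
        intro hj h
        rcases lt_or_ge u (shiftDen c (2 * l + 1) + (j + 1) * shiftDen c (2 * l + 2)) with h₁ | h₁
        · exact ihj (by omega) h₁
        · refine Or.inr ⟨l, by omega, j + 1, Finset.mem_Icc.2 ⟨by omega, hj.le⟩,
            by push_cast; exact h₁, ?_⟩
          exact lower_approx (E.rem_pos (2 * l + 2) (by omega)).le
            (E.rem_intermediate_pos (by omega) hj.le) hu h hpos
    rcases lt_or_ge u (shiftDen c (2 * l + 3)) with h₁ | h₁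
    · refine step (c (2 * l + 2) - 1) (by omega) ?_
      have : ((c (2 * l + 2) - 1 : ℕ) : ℤ) + 1 = c (2 * l + 2) := by
        rw [Nat.cast_sub hc]; push_cast; ring
      rw [this]
      linarith
    · refine Or.inr ⟨l, by omega, c (2 * l + 2), Finset.mem_Icc.2 ⟨hc, le_rfl⟩, by linarith, ?_⟩
      rw [← hD]
      have h₂ := E.rem_pos (2 * l + 3) (by omega)
      have := lower_approx (d := d) (m := m) (c := c) (l := l + 1) (j := 0) (x := u) (y := y)
        (E.rem_pos (2 * (l + 1) + 2) (by omega)).le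
        (by simpa [show 2 * (l + 1) + 1 = 2 * l + 3 by ring] using h₂) hu
        (by simpa using hu') hpos
      simpa [show 2 * (l + 1) + 1 = 2 * l + 3 by ring] using this

theorem base_eq_origin (E : IsDigitExpansion d m B s c e) {l : ℕ} (hl : 2 * l ≤ s)
    (h0 : ∀ k < l, e (2 * k + 2) = 0) :
    digitDen c e (2 * l) - shiftDen c (2 * l) = 0 ∧
    digitNum c e (2 * l) - shiftNum c (2 * l) = -1 := by
  induction l with
  | zero => simp [digitDen, shiftDen, digitNum, shiftNum]
  | succ l ih =>
    have := E.base_succ_of_digit_eq_zero (l := l) (by omega) (h0 l (by omega))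
    rw [show 2 * (l + 1) = 2 * l + 2 by ring, this.1, this.2]
    exact ih (by omega) fun k hk => h0 k (by omega)

theorem digit_pos_of_even_digits_eq_zero (E : IsDigitExpansion d m B s c e) {l : ℕ}
    (hl : 2 * l + 1 ≤ s) (h0 : ∀ k < l, e (2 * k + 2) = 0) : 0 < e (2 * l + 1) := by
  by_contra h
  obtain ⟨h₁, h₂⟩ := E.prev_full (2 * l + 1) (by omega) hl (by omega)
  obtain ⟨k, rfl⟩ : ∃ k, l = k + 1 := ⟨l - 1, by omega⟩
  have h₃ := h0 k (by omega)
  have h₄ := E.quot_pos (2 * k + 2) (by omega) (by omega)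
  rw [show 2 * (k + 1) + 1 - 1 = 2 * k + 2 by omega] at h₂
  omega

theorem digitDen_odd_of_even_digits_eq_zero (E : IsDigitExpansion d m B s c e) {l : ℕ}
    (hl : 2 * l + 1 ≤ s) (h0 : ∀ k < l, e (2 * k + 2) = 0) :
    digitDen c e (2 * l + 1) = shiftDen c (2 * l) + e (2 * l + 1) * shiftDen c (2 * l + 1) := by
  have := (E.base_eq_origin (l := l) (by omega) h0).1
  simp only [digitDen]
  linarith

/-- Before the first record of the expansion, no positive value is smaller than `d - B`. -/
theorem le_of_lt_first (E : IsDigitExpansion d m B s c e) {l : ℕ}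
    (hl : 2 * l + 1 ≤ s) (h0 : ∀ k < l, e (2 * k + 2) = 0) {u h : ℤ} (hu : 0 < u)
    (hu' : u < digitDen c e (2 * l + 1)) (hpos : 0 < u * m - h * d - B) :
    d - B ≤ u * m - h * d - B := by
  rw [E.digitDen_odd_of_even_digits_eq_zero hl h0] at hu'
  obtain ⟨h₁, h₂⟩ := E.base_eq_origin (l := l) (by omega) h0
  have h₃ := digitRem_base_form d m B c e l
  rw [h₁, h₂] at h₃
  by_contra! hlt
  have := E.gap_jump (l := l) (by omega) (by omega) (x := u) (y := h + 1) hu hu' (by linarith)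
  linarith

theorem shiftDen_odd_mono (c : ℕ → ℕ) : Monotone fun k => shiftDen c (2 * k + 1) := by
  refine monotone_nat_of_le_succ fun k => ?_
  have h₁ := shiftDen_nonneg c (2 * k + 2)
  have : (0 : ℤ) ≤ c (2 * k + 2) * shiftDen c (2 * k + 2) := by positivity
  show shiftDen c (2 * k + 1) ≤ c (2 * k + 2) * shiftDen c (2 * k + 2) + shiftDen c (2 * k + 1)
  linarith

theorem intermediate_le (c : ℕ → ℕ) {k l j : ℕ} (hk : k < l) (hj : j ≤ c (2 * k + 2)) :
    shiftDen c (2 * k + 1) + j * shiftDen c (2 * k + 2) ≤ shiftDen c (2 * l + 1) := by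
  have h₁ : shiftDen c (2 * (k + 1) + 1) ≤ shiftDen c (2 * l + 1) := shiftDen_odd_mono c hk
  have h₂ : shiftDen c (2 * (k + 1) + 1)
    = c (2 * k + 2) * shiftDen c (2 * k + 2) + shiftDen c (2 * k + 1) := rfl
  have h₃ : (j : ℤ) ≤ c (2 * k + 2) := by exact_mod_cast hj
  have := mul_le_mul_of_nonneg_right h₃ (shiftDen_nonneg c (2 * k + 2))
  linarith

/-- The records over `u ≥ 1` that are not records over `u ≥ 0`. -/
theorem low_record_iff (E : IsDigitExpansion d m B s c e) (hB : 0 < B) (hBd : B < d)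
    (hmd : m < d) (hs1 : 1 < digitDen c e s) (hsd : digitDen c e s < d)
    (hdvd : ∀ u : ℤ, 0 < u → u < d → ¬ d ∣ u * m) {l : ℕ} (hl : 2 * l + 1 ≤ s)
    (h0 : ∀ k < l, e (2 * k + 2) = 0)
    (hlast : 2 * l + 1 = s ∨ (2 * l + 2 ≤ s ∧ 0 < e (2 * l + 2)))
    {u h : ℤ} (hu : 0 < u) (hus : u < digitDen c e s) :
    (IsRecord d m B 1 u h ∧ d - B < u * m - h * d - B) ↔
      (u = 1 ∧ h = -1 ∧ m < B) ∨ ∃ k < l, ∃ j ∈ Finset.Icc 1 (c (2 * k + 2)),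
        u = shiftDen c (2 * k + 1) + j * shiftDen c (2 * k + 2) ∧
        h = shiftNum c (2 * k + 1) + j * shiftNum c (2 * k + 2) - 1 := by
  have hm : 0 < m := E.rem_pos 1 (by omega)
  have hd : 0 < d := hB.trans hBd
  have hform : ∀ k j : ℕ, (shiftDen c (2 * k + 1) + j * shiftDen c (2 * k + 2)) * m
      - (shiftNum c (2 * k + 1) + j * shiftNum c (2 * k + 2)) * d
      = euclidRem d m c (2 * k + 1) - j * euclidRem d m c (2 * k + 2) := fun k j => by
    linear_combination euclidRem_odd d m c k - (j : ℤ) * euclidRem_even d m c (k + 1)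
  have hU := E.digitDen_odd_of_even_digits_eq_zero hl h0
  have he := E.digit_pos_of_even_digits_eq_zero hl h0
  have hQ := E.shiftDen_pos (n := 2 * l) (by omega)
  have hQ' := shiftDen_nonneg c (2 * l)
  have hQe : shiftDen c (2 * l + 1) ≤ e (2 * l + 1) * shiftDen c (2 * l + 1) := by
    have : (1 : ℤ) ≤ e (2 * l + 1) := by exact_mod_cast he
    nlinarith
  have hmB : m ≠ B := by
    intro h
    have h₁ := E.form_eq_zero
    exact hdvd (digitDen c e s - 1) (by linarith) (by linarith)
      ⟨digitNum c e s, by linear_combination h₁ - h⟩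
  constructor
  · rintro ⟨hr, hlow⟩
    have huU : u < digitDen c e (2 * l + 1) := by
      rcases hlast with h₁ | ⟨h₁, h₂⟩
      · rw [h₁]; exact hus
      · by_contra! hle
        obtain ⟨hb, -⟩ := E.records_upto hd hB.le hBd (l := l) (by omega)
        have hrec := (E.records_digit hd hB.le hBd h₁ hb h₂).1
        simp only [Nat.cast_zero, zero_mul, add_zero] at hrec
        have h₃ : digitDen c e (2 * l + 1) * m - digitNum c e (2 * l + 1) * d - B < d - B := by
          rcases hrec.2.2 0 (-1) le_rfl hrec.1 (by linarith) with h₃ | h₃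
          · linarith [h₃.1]
          · linarith
        rcases hr.2.2 _ _ (by linarith) hle hrec.2.1 with ⟨h₄, h₅⟩ | h₄
        · rw [← h₄, ← h₅] at hlow; linarith
        · linarith
    have hcov := E.lower_cover hl (u := u) (y := h + 1) hu (by
      have h₁ : (e (2 * l + 1) : ℤ) ≤ c (2 * l + 1) := by
        exact_mod_cast E.digit_le _ (by omega) hl
      have h₂ : shiftDen c (2 * l + 2)
        = c (2 * l + 1) * shiftDen c (2 * l + 1) + shiftDen c (2 * l) := rfl
      nlinarith) (by linarith)
    rcases hcov with h₁ | ⟨k, hk, j, hj, h₁, h₂⟩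
    · left
      have h₂ : u = 1 ∧ h = -1 := by
        rcases hr.2.2 1 (-1) le_rfl hu (by linarith) with ⟨h₂, h₃⟩ | h₂
        · exact ⟨h₂.symm, h₃.symm⟩
        · linarith
      obtain ⟨rfl, rfl⟩ := h₂
      refine ⟨rfl, rfl, ?_⟩
      by_contra! h₃
      have h₄ : B < m := lt_of_le_of_ne h₃ hmB.symm
      rcases hr.2.2 1 0 le_rfl le_rfl (by linarith) with ⟨h₅, h₆⟩ | h₅
      · omega
      · linarith
    · right
      rw [Finset.mem_Icc] at hj
      have hp := E.rem_intermediate_pos (l := k) (j := j) (by omega) hj.2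
      have hf := hform k j
      have hq := E.shiftDen_pos (n := 2 * k) (by omega)
      have hq' : 0 ≤ j * shiftDen c (2 * k + 2) :=
        mul_nonneg (by positivity) (shiftDen_nonneg c _)
      refine ⟨k, hk, j, Finset.mem_Icc.2 hj, ?_⟩
      rcases hr.2.2 (shiftDen c (2 * k + 1) + j * shiftDen c (2 * k + 2))
        (shiftNum c (2 * k + 1) + j * shiftNum c (2 * k + 2) - 1) (by linarith) h₁
        (by linarith) with ⟨h₃, h₄⟩ | h₃
      · exact ⟨h₃.symm, h₄.symm⟩
      · linarith
  · rintro (⟨rfl, rfl, hlt⟩ | ⟨k, hk, j, hj, rfl, rfl⟩)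
    · refine ⟨⟨le_rfl, by linarith, fun u' h' h₁ h₂ h₃ => ?_⟩, by linarith⟩
      obtain rfl : u' = 1 := le_antisymm h₂ h₁
      rcases lt_trichotomy h' (-1) with h₄ | h₄ | h₄
      · right; nlinarith
      · exact Or.inl ⟨rfl, h₄⟩
      · exfalso
        have : 0 ≤ h' * d := mul_nonneg (by omega) hd.le
        linarith
    · rw [Finset.mem_Icc] at hj
      have hp := E.rem_intermediate_pos (l := k) (j := j) (by omega) hj.2
      have hf := hform k j
      have hle := intermediate_le c hk hj.2
      refine ⟨⟨by omega, by linarith, fun u' h' h₁ h₂ h₃ => ?_⟩, by linarith⟩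
      have h₄ := E.le_of_lt_first hl h0 (u := u') (h := h') (by linarith)
        (by
          rcases Nat.eq_zero_or_pos l with rfl | hl0
          · omega
          · obtain ⟨l', rfl⟩ : ∃ l', l = l' + 1 := ⟨l - 1, by omega⟩
            have := E.shiftDen_pos (n := 2 * l' + 1) (by omega)
            rw [show 2 * l' + 1 + 1 = 2 * (l' + 1) by ring] at this
            linarith) h₃
      have h₅ : 0 < u' * m - (h' + 1) * d := by
        rcases h₄.eq_or_lt with h₅ | h₅
        · exact absurd ⟨h' + 1, by linarith⟩ (hdvd u' (by linarith) (by linarith))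
        · linarith
      rcases h₂.eq_or_lt with rfl | h₂
      · have hmax : euclidRem d m c (2 * k + 1) < d := by
          have hanti : ∀ n, 2 * n + 1 ≤ s + 1 → euclidRem d m c (2 * n + 1) ≤ m := by
            intro n
            induction n with
            | zero => intro _; exact le_rfl
            | succ n ih =>
              intro hn
              exact (E.euclidRem_add_two_le (n := 2 * n + 1) (by omega)).trans (ih (by omega))
          linarith [hanti k (by omega)]
        have h₆ := E.rem_pos (2 * k + 2) (by omega)
        have h₇ : 0 ≤ j * euclidRem d m c (2 * k + 2) := by positivity
        set h₀ := shiftNum c (2 * k + 1) + j * shiftNum c (2 * k + 2) with hh₀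
        rcases lt_trichotomy h' (h₀ - 1) with h₈ | h₈ | h₈
        · right; nlinarith
        · exact Or.inl ⟨rfl, h₈⟩
        · exfalso
          nlinarith
      · right
        obtain ⟨i, rfl⟩ : ∃ i, j = i + 1 := ⟨j - 1, by omega⟩
        push_cast at h₂ hf ⊢
        have h₆ := lower_approx (d := d) (m := m) (c := c) (l := k) (j := i) (x := u')
          (y := h' + 1) (E.rem_pos (2 * k + 2) (by omega)).le
          (E.rem_intermediate_pos (by omega) (by omega)) (by linarith) h₂ h₅
        have h₇ := E.rem_pos (2 * k + 2) (by omega)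
        linarith

end IsDigitExpansion

/-- A set indexed by blocks of pairwise distinct elements has the expected cardinality. -/
theorem encard_blocks {I : Finset ℕ} {J : ℕ → Finset ℕ} {g : ℕ → ℤ} (hg : Monotone g)
    {U X : ℕ → ℕ → ℤ} (hU : ∀ k ∈ I, ∀ j ∈ J k, g k < U k j ∧ U k j ≤ g (k + 1))
    (hinj : ∀ k ∈ I, ∀ j ∈ J k, ∀ j' ∈ J k, U k j = U k j' → j = j')
    (hX : ∀ k ∈ I, ∀ j ∈ J k, ∀ k' ∈ I, ∀ j' ∈ J k', X k j = X k' j' → U k j = U k' j') :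
    {x | ∃ k ∈ I, ∃ j ∈ J k, x = X k j}.encard = ((∑ k ∈ I, (J k).card : ℕ) : ℕ∞) := by
  have hset : {x | ∃ k ∈ I, ∃ j ∈ J k, x = X k j}
      = (fun p : Σ _ : ℕ, ℕ => X p.1 p.2) '' (I.sigma J : Set (Σ _ : ℕ, ℕ)) := by
    ext x
    simp only [Set.mem_ofPred_eq, Set.mem_image, Finset.mem_coe, Finset.mem_sigma, Sigma.exists]
    constructor
    · rintro ⟨k, hk, j, hj, rfl⟩
      exact ⟨k, j, ⟨hk, hj⟩, rfl⟩
    · rintro ⟨k, j, ⟨hk, hj⟩, rfl⟩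
      exact ⟨k, hk, j, hj, rfl⟩
  rw [hset, Set.InjOn.encard_image, Set.encard_coe_eq_coe_finsetCard, Finset.card_sigma]
  rintro ⟨k, j⟩ hp ⟨k', j'⟩ hp' heq
  simp only [Finset.mem_coe, Finset.mem_sigma] at hp hp' heq
  have h := hX k hp.1 j hp.2 k' hp'.1 j' hp'.2 heq
  obtain rfl : k = k' := by
    have h₁ := hU k hp.1 j hp.2
    have h₂ := hU k' hp'.1 j' hp'.2
    rcases lt_trichotomy k k' with hlt | rfl | hlt
    · have := hg (show k + 1 ≤ k' from hlt); omega
    · rfl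
    · have := hg (show k' + 1 ≤ k from hlt); omega
  rw [hinj k hp.1 j hp.2 j' hp'.2 h]

theorem cfBracket_pos : ∀ l : List ℕ, l ≠ [] → (∀ x ∈ l, 0 < x) → 0 < cfBracket l
  | [], h, _ => absurd rfl h
  | [x], _, h => by
    have : 0 < x := h x (by simp)
    simpa [cfBracket] using this
  | x :: y :: l, _, h => by
    have h₁ := cfBracket_pos (y :: l) (by simp) fun z hz => h z (List.mem_cons_of_mem _ hz)
    have h₂ : 0 < x := h x (by simp)
    simp only [cfBracket]
    positivity

theorem cfBracket_cons (x : ℕ) {l : List ℕ} (hl : l ≠ []) :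
    cfBracket (x :: l) = x + 1 / cfBracket l := by
  cases l with
  | nil => exact absurd rfl hl
  | cons y l => rfl

theorem euclidRem_pos_of_cfBracket {d m : ℤ} {c : ℕ → ℕ} {k : ℕ} : ∀ {n : ℕ},
    (∀ i, n < i → i ≤ n + k → 0 < c i) → 0 < euclidRem d m c (n + 1) →
    (euclidRem d m c n : ℚ)
      = euclidRem d m c (n + 1) * cfBracket ((List.range' (n + 1) k).map c ++ [1]) →
    ∀ i, n < i → i ≤ n + k + 1 → 0 < euclidRem d m c i := by
  induction k with
  | zero =>
    intro n _ h _ i h₁ h₂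
    obtain rfl : i = n + 1 := by omega
    exact h
  | succ k ih =>
    intro n hc hpos heq i h₁ h₂
    rcases eq_or_lt_of_le (show n + 1 ≤ i from h₁) with rfl | h₃
    · exact hpos
    · have hy : 0 < cfBracket ((List.range' (n + 2) k).map c ++ [1]) := by
        refine cfBracket_pos _ (by simp) fun x hx => ?_
        simp only [List.mem_append, List.mem_map, List.mem_range'_1, List.mem_singleton] at hx
        rcases hx with ⟨a, ha, rfl⟩ | rfl
        · exact hc a (by omega) (by omega)
        · exact one_pos
      rw [List.range'_succ, List.map_cons, List.cons_append, cfBracket_cons _ (by simp),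
        show n + 1 + 1 = n + 2 by ring] at heq
      have hD : (euclidRem d m c (n + 2) : ℚ) = euclidRem d m c (n + 1)
          / cfBracket ((List.range' (n + 2) k).map c ++ [1]) := by
        simp only [euclidRem]
        push_cast
        rw [heq]
        field_simp
        ring
      have hpos' : 0 < euclidRem d m c (n + 2) := by
        have h₄ : (0 : ℚ) < euclidRem d m c (n + 1) := by exact_mod_cast hpos
        have : (0 : ℚ) < euclidRem d m c (n + 2) := by rw [hD]; positivity
        exact_mod_cast this
      refine ih (n := n + 1) (fun i h₄ h₅ => hc i (by omega) (by omega)) hpos' ?_ i h₃ (by omega)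
      rw [show n + 1 + 1 = n + 2 by ring, hD]
      field_simp

theorem shiftDen_mul_euclidRem (d m : ℤ) (c : ℕ → ℕ) (n : ℕ) :
    shiftDen c (n + 1) * euclidRem d m c n + shiftDen c n * euclidRem d m c (n + 1) = d := by
  induction n with
  | zero => simp [shiftDen, euclidRem]
  | succ n ih =>
    simp only [shiftDen, euclidRem]
    linear_combination ih

theorem IsDigitExpansion.digitDen_lt {d m B : ℤ} {s : ℕ} {c e : ℕ → ℕ}
    (E : IsDigitExpansion d m B s c e) : digitDen c e s < d := by
  have h : ∀ n, n ≤ s → digitDen c e n + 1 ≤ shiftDen c n + shiftDen c (n + 1) := by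
    intro n
    induction n with
    | zero => intro _; simp [digitDen, shiftDen]
    | succ n ih =>
      intro hn
      have h₁ := ih (by omega)
      have h₂ : (e (n + 1) : ℤ) ≤ c (n + 1) := by exact_mod_cast E.digit_le _ (by omega) hn
      have := mul_le_mul_of_nonneg_right h₂ (shiftDen_nonneg c (n + 1))
      simp only [digitDen, shiftDen]
      linarith
  have h₁ := shiftDen_mul_euclidRem d m c s
  have h₂ := E.rem_pos s (by omega)
  have h₃ := E.rem_pos (s + 1) le_rfl
  have h₄ := h s le_rfl
  have h₅ := shiftDen_nonneg c s
  have h₆ := shiftDen_nonneg c (s + 1)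
  nlinarith [mul_nonneg h₅ (show 0 ≤ euclidRem d m c (s + 1) - 1 by linarith),
    mul_nonneg h₆ (show 0 ≤ euclidRem d m c s - 1 by linarith)]

theorem convDen_eq_shiftDen (c : ℕ → ℕ) : ∀ n, (convDen c n : ℤ) = shiftDen c (n + 1)
  | 0 => by simp [convDen, shiftDen]
  | 1 => by simp [convDen, shiftDen]
  | n + 2 => by
    have h₁ := convDen_eq_shiftDen c n
    have h₂ := convDen_eq_shiftDen c (n + 1)
    rw [show shiftDen c (n + 2 + 1)
      = c (n + 2) * shiftDen c (n + 1 + 1) + shiftDen c (n + 1) from rfl, ← h₁, ← h₂]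
    simp [convDen]

theorem convNum_eq_shiftNum {c : ℕ → ℕ} (hc : c 0 = 0) :
    ∀ n, (convNum c n : ℤ) = shiftNum c (n + 1)
  | 0 => by simp [convNum, shiftNum, hc]
  | 1 => by simp [convNum, shiftNum, hc]
  | n + 2 => by
    have h₁ := convNum_eq_shiftNum hc n
    have h₂ := convNum_eq_shiftNum hc (n + 1)
    rw [show shiftNum c (n + 2 + 1)
      = c (n + 2) * shiftNum c (n + 1 + 1) + shiftNum c (n + 1) from rfl, ← h₁, ← h₂]
    simp [convNum]

theorem sum_Icc_mul_form (c e : ℕ → ℕ) (x y : ℤ) (n : ℕ) :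
    ∑ j ∈ Finset.Icc 1 n, (e j : ℤ) * (x * shiftDen c j - y * shiftNum c j)
      = x * digitDen c e n - y * digitNum c e n := by
  induction n with
  | zero => simp [digitDen, digitNum]
  | succ n ih =>
    rw [Finset.sum_Icc_succ_top (by omega), ih]
    simp only [digitDen, digitNum]
    ring

theorem IsNumeration.isDigitExpansion {d m : ℤ} {B : ℤ} {α β : ℚ} {r s : ℕ} {c e : ℕ → ℕ}
    (hd : 0 < d) (hm : 0 < m) (hα : α = m / d) (hβ : β * d = B) (hc : IsCFE α r c)
    (he : IsNumeration α r c β s e) : IsDigitExpansion d m B s c e := by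
  obtain ⟨hc0, hcpos, hcf⟩ := hc
  obtain ⟨hadm, hsum, hs, hes, hzero⟩ := he
  rw [Finset.mem_Icc] at hs
  have hd' : (0 : ℚ) < d := by exact_mod_cast hd
  have hm' : (0 : ℚ) < m := by exact_mod_cast hm
  have hrem : ∀ n ≤ r + 1, 0 < euclidRem d m c n := by
    intro n hn
    rcases Nat.eq_zero_or_pos n with rfl | hn0
    · exact hd
    · refine euclidRem_pos_of_cfBracket (n := 0) (k := r)
        (fun i h₁ h₂ => hcpos i (Finset.mem_Icc.2 ⟨h₁, by omega⟩)) hm ?_ n hn0 (by omega)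
      rw [List.range_eq_range', List.range'_succ, List.map_cons, List.cons_append,
        cfBracket_cons _ (by simp), hc0, hα] at hcf
      simp only [euclidRem, zero_add] at hcf ⊢
      set y := cfBracket (List.map c (List.range' 1 r) ++ [1]) with hy
      have hy0 : y ≠ 0 := by
        intro h0
        rw [h0] at hcf
        have : (m : ℚ) / d ≠ 0 := by positivity
        simp at hcf
        rcases hcf with h | h
        · omega
        · omega
      field_simp at hcf
      push_cast at hcf
      linarith
  refine ⟨fun n hn => hrem n (by omega), fun i h₁ h₂ => hcpos i (Finset.mem_Icc.2 ⟨h₁, by omega⟩),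
    fun i h₁ h₂ => (hadm i (Finset.mem_Icc.2 ⟨h₁, by omega⟩)).1, fun i h₁ h₂ h₃ => ?_, hs.1, hes, ?_⟩
  · rcases (hadm i (Finset.mem_Icc.2 ⟨h₁, by omega⟩)).2 h₃ with h | h
    · have := h s (Finset.mem_Icc.2 ⟨h₂, hs.2⟩)
      omega
    · exact h
  · have hB : digitDen c e s * m - digitNum c e s * d - B = 0 := by
      have h₁ : β * d = ∑ j ∈ Finset.Icc 1 s,
          ((e j : ℤ) * (m * shiftDen c j - d * shiftNum c j) : ℤ) := by
        rw [hsum, Finset.sum_mul, ← Finset.sum_subset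
          (Finset.Icc_subset_Icc_right hs.2 : Finset.Icc 1 s ⊆ Finset.Icc 1 r)]
        · push_cast
          refine Finset.sum_congr rfl fun j hj => ?_
          rw [Finset.mem_Icc] at hj
          obtain ⟨i, rfl⟩ : ∃ i, j = i + 1 := ⟨j - 1, by omega⟩
          have h₁ := convDen_eq_shiftDen c i
          have h₂ := convNum_eq_shiftNum hc0 i
          rw [Nat.add_sub_cancel, ← h₁, ← h₂, hα]
          push_cast
          field_simp
        · intro j hj hj'
          rw [Finset.mem_Icc] at hj hj'
          rw [hzero j (Finset.mem_Icc.2 ⟨by omega, hj.2⟩)]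
          simp
      rw [hβ] at h₁
      norm_cast at h₁
      rw [sum_Icc_mul_form] at h₁
      linarith
    rcases Nat.even_or_odd' s with ⟨n, rfl | rfl⟩
    · linarith [(digitRem_even_odd d m B c e n).1]
    · linarith [(digitRem_even_odd d m B c e n).2]

theorem mem_intCarrier_quotient_iff {a b d : ℕ} (hd : 0 < d) {x : ℤ} :
    x ∈ intCarrier (semigroupQuotient (genTwo a b) d) ↔
      ∃ u v : ℤ, 0 ≤ u ∧ 0 ≤ v ∧ d * x = a * u + b * v := by
  constructor
  · rintro ⟨n, hn, rfl⟩
    have hn' : d * n ∈ AddSubmonoid.closure {a, b} := hn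
    obtain ⟨u, v, h⟩ := (AddSubmonoid.mem_closure_pair _ _ _).1 hn'
    refine ⟨u, v, by positivity, by positivity, ?_⟩
    simp only [smul_eq_mul] at h
    have h' : ((u * a + v * b : ℕ) : ℤ) = (d * n : ℕ) := by rw [h]
    push_cast at h'
    linarith
  · rintro ⟨u, v, hu, hv, h⟩
    have hx : 0 ≤ x := by
      have h₁ : (0 : ℤ) ≤ d * x := by rw [h]; positivity
      exact nonneg_of_mul_nonneg_right h₁ (by exact_mod_cast hd)
    lift x to ℕ using hx
    lift u to ℕ using hu
    lift v to ℕ using hv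
    refine ⟨x, ?_, rfl⟩
    show d * x ∈ AddSubmonoid.closure {a, b}
    refine (AddSubmonoid.mem_closure_pair _ _ _).2 ⟨u, v, ?_⟩
    norm_cast at h
    simp only [smul_eq_mul]
    linarith

theorem mem_pseudoFrobenius_add {S : AddSubmonoid ℕ} {x : ℤ} (hx : x ∈ pseudoFrobenius S) {g : ℤ}
    (hg : g ∈ intCarrier S) (hg0 : g ≠ 0) : x + g ∈ intCarrier S := by
  by_contra h
  have := hx.2 (x + g) h (by simpa [semigroupLE] using hg)
  omega

/-- If the opposite of a pseudo-Frobenius number `x < 0` of `S` belongs to `S`, it divides all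
the elements of `S`. -/
theorem dvd_of_neg_mem_pseudoFrobenius {S : AddSubmonoid ℕ} {g : ℕ} (hg : 0 < g)
    (hpf : -(g : ℤ) ∈ pseudoFrobenius S) : ∀ n ∈ S, g ∣ n := by
  intro n
  induction n using Nat.strong_induction_on with
  | _ n ih =>
    intro hn
    rcases Nat.eq_zero_or_pos n with rfl | hn0
    · exact dvd_zero g
    · obtain ⟨k, hk, hkn⟩ := mem_pseudoFrobenius_add hpf (g := n) ⟨n, hn, rfl⟩ (by omega)
      have hnk : n = k + g := by omega
      rw [hnk]
      exact (Nat.dvd_add_left (dvd_refl g)).2 (ih k (by omega) hk)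

/-- The lattice description of `⟨a, b⟩ / d`: here `τ * d = a * m + b` and `b = d * (f + 1) - B`. -/
structure IsLatticeDatum (a b d : ℕ) (m τ f B : ℤ) : Prop where
  a_pos : 1 < a
  a_lt : a < d
  coprime_ab : a.Coprime b
  coprime_ad : a.Coprime d
  tau_mul : τ * d = a * m + b
  b_eq : (b : ℤ) = d * (f + 1) - B
  B_pos : 0 < B
  B_lt : B < d

namespace IsLatticeDatum

variable {a b d : ℕ} {m τ f B : ℤ}

theorem isCoprime (L : IsLatticeDatum a b d m τ f B) : IsCoprime (a : ℤ) τ := by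
  obtain ⟨x, y, h⟩ := (Nat.isCoprime_iff_coprime.2 L.coprime_ab : IsCoprime (a : ℤ) b)
  exact ⟨x - y * m, y * d, by linear_combination h + y * L.tau_mul⟩

theorem mem_iff_exists (L : IsLatticeDatum a b d m τ f B) {x : ℤ} :
    x ∈ intCarrier (semigroupQuotient (genTwo a b) d) ↔
      ∃ v w : ℤ, 0 ≤ v ∧ 0 ≤ m * v + d * w ∧ x = τ * v + a * w := by
  have hd : 0 < d := by have := L.a_pos; have := L.a_lt; omega
  rw [mem_intCarrier_quotient_iff hd]
  have hd' : (d : ℤ) ≠ 0 := by exact_mod_cast hd.ne'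
  have ht := L.tau_mul
  constructor
  · rintro ⟨u, v, hu, hv, h⟩
    have h₁ : (a : ℤ) * (u - m * v) = d * (x - τ * v) := by linear_combination v * ht - h
    have h₂ : (d : ℤ) ∣ u - m * v :=
      (Nat.isCoprime_iff_coprime.2 L.coprime_ad).symm.dvd_of_dvd_mul_left ⟨_, h₁⟩
    obtain ⟨w, hw⟩ := h₂
    refine ⟨v, w, hv, by linarith, ?_⟩
    apply mul_left_cancel₀ hd'
    linear_combination (-1 : ℤ) * h₁ + a * hw
  · rintro ⟨v, w, hv, hw, rfl⟩
    exact ⟨m * v + d * w, v, hw, hv, by linear_combination v * ht⟩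

theorem dvd_of_combination_eq (L : IsLatticeDatum a b d m τ f B) {v w v' w' : ℤ}
    (h : τ * v + a * w = τ * v' + a * w') : ∃ k, v' = v + a * k ∧ w' = w - τ * k := by
  have ha : (a : ℤ) ≠ 0 := by have := L.a_pos; positivity
  have h₁ : (a : ℤ) ∣ v' - v := L.isCoprime.dvd_of_dvd_mul_left ⟨w - w', by linear_combination -h⟩
  obtain ⟨k, hk⟩ := h₁
  refine ⟨k, by linarith, mul_left_cancel₀ ha ?_⟩
  linear_combination (-1 : ℤ) * h - τ * hk

theorem mem_iff (L : IsLatticeDatum a b d m τ f B) {v w : ℤ} (hv : 0 ≤ v) (hva : v < a) :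
    τ * v + a * w ∈ intCarrier (semigroupQuotient (genTwo a b) d) ↔ 0 ≤ m * v + d * w := by
  rw [L.mem_iff_exists]
  constructor
  · rintro ⟨v', w', hv', hw', h⟩
    obtain ⟨k, rfl, rfl⟩ := L.dvd_of_combination_eq h
    have hk : 0 ≤ k := by
      by_contra! hk
      nlinarith
    have : (0 : ℤ) ≤ b * k := by positivity
    linear_combination hw' + this - k * L.tau_mul
  · intro h
    exact ⟨v, w, hv, h, rfl⟩

theorem not_mem_iff (L : IsLatticeDatum a b d m τ f B) {u h : ℤ} (hu : 1 ≤ u) (hua : u ≤ a) :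
    a * f + a + a * h - τ * u ∉ intCarrier (semigroupQuotient (genTwo a b) d) ↔
      0 < u * m - h * d - B := by
  have := L.mem_iff (v := a - u) (w := f + 1 + h - τ) (by linarith) (by linarith)
  rw [show a * f + a + a * h - τ * u = τ * (a - u) + a * (f + 1 + h - τ) by ring, this, not_le]
  have ht := L.tau_mul
  have hb := L.b_eq
  have heq : m * (a - u) + d * (f + 1 + h - τ) = -(u * m - h * d - B) := by
    linear_combination (-1 : ℤ) * ht - hb
  rw [heq]
  constructor <;> intro h <;> linarith

theorem exists_repr (L : IsLatticeDatum a b d m τ f B) (x : ℤ) :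
    ∃ u h : ℤ, 1 ≤ u ∧ u ≤ a ∧ x = a * f + a + a * h - τ * u := by
  have ha : (0 : ℤ) < a := by have := L.a_pos; positivity
  obtain ⟨i, j, hij⟩ := L.isCoprime
  set y := a * f + a - x with hy
  refine ⟨(y * j - 1) % a + 1, -(τ * ((y * j - 1) / a)) - y * i, ?_, ?_, ?_⟩
  · have := Int.emod_nonneg (y * j - 1) ha.ne'
    linarith
  · have := Int.emod_lt_of_pos (y * j - 1) ha
    linarith
  · have := Int.emod_add_mul_ediv (y * j - 1) a
    linear_combination hy + y * hij + τ * this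

theorem repr_unique (L : IsLatticeDatum a b d m τ f B) {u h u' h' : ℤ} (hu : 1 ≤ u) (hua : u ≤ a)
    (hu' : 1 ≤ u') (hua' : u' ≤ a)
    (heq : a * f + a + a * h - τ * u = a * f + a + a * h' - τ * u') : u = u' ∧ h = h' := by
  obtain ⟨k, h₁, h₂⟩ := L.dvd_of_combination_eq (v := u) (w := -h) (v' := u') (w' := -h')
    (by linarith)
  have ha : (0 : ℤ) < a := by linarith
  have hk : k = 0 := by
    have h₃ : k < 1 := by nlinarith
    have h₄ : -1 < k := by nlinarith
    omega
  subst hk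
  constructor <;> linarith

theorem sub_mem_iff (L : IsLatticeDatum a b d m τ f B) {u h u' h' : ℤ} (hu : 1 ≤ u) (hua : u ≤ a)
    (hu' : 1 ≤ u') (hua' : u' ≤ a) :
    (a * f + a + a * h' - τ * u') - (a * f + a + a * h - τ * u)
        ∈ intCarrier (semigroupQuotient (genTwo a b) d) ↔
      (u' ≤ u ∧ u' * m - h' * d - B ≤ u * m - h * d - B) ∨
      (u < u' ∧ u' * m - h' * d - B + b ≤ u * m - h * d - B) := by
  have ht := L.tau_mul
  rcases le_or_gt u' u with hle | hlt
  · have := L.mem_iff (v := u - u') (w := h' - h) (by linarith) (by linarith)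
    rw [show (a * f + a + a * h' - τ * u') - (a * f + a + a * h - τ * u)
      = τ * (u - u') + a * (h' - h) by ring, this]
    constructor
    · intro h₁
      exact Or.inl ⟨hle, by linarith⟩
    · rintro (⟨-, h₁⟩ | ⟨h₁, -⟩) <;> linarith
  · have := L.mem_iff (v := u - u' + a) (w := h' - h - τ) (by linarith) (by linarith)
    rw [show (a * f + a + a * h' - τ * u') - (a * f + a + a * h - τ * u)
      = τ * (u - u' + a) + a * (h' - h - τ) by ring, this]
    constructor
    · intro h₁
      exact Or.inr ⟨hlt, by linarith⟩
    · rintro (⟨h₁, -⟩ | ⟨-, h₁⟩) <;> linarith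

theorem mem_pseudoFrobenius_iff (L : IsLatticeDatum a b d m τ f B) {u h : ℤ}
    (hu : 1 ≤ u) (hua : u ≤ a) :
    a * f + a + a * h - τ * u ∈ pseudoFrobenius (semigroupQuotient (genTwo a b) d) ↔
      IsRecord d m B 1 u h ∧ ∀ u' h' : ℤ, u < u' → u' ≤ a → 0 < u' * m - h' * d - B →
        u * m - h * d - B < u' * m - h' * d - B + b := by
  constructor
  · rintro ⟨h₁, h₂⟩
    rw [L.not_mem_iff hu hua] at h₁
    have key : ∀ u' h' : ℤ, 1 ≤ u' → u' ≤ a → 0 < u' * m - h' * d - B →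
        ((u' ≤ u ∧ u' * m - h' * d - B ≤ u * m - h * d - B) ∨
        (u < u' ∧ u' * m - h' * d - B + b ≤ u * m - h * d - B)) → u' = u ∧ h' = h := by
      intro u' h' hu' hua' hpos hle
      exact L.repr_unique hu' hua' hu hua
        (h₂ _ ((L.not_mem_iff hu' hua').2 hpos) ((L.sub_mem_iff hu hua hu' hua').2 hle))
    refine ⟨⟨hu, h₁, fun u' h' h₃ h₄ h₅ => ?_⟩, fun u' h' h₃ h₄ h₅ => ?_⟩
    · by_cases h₆ : u' * m - h' * d - B ≤ u * m - h * d - B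
      · exact Or.inl (key u' h' h₃ (by linarith) h₅ (Or.inl ⟨h₄, h₆⟩))
      · exact Or.inr (not_le.1 h₆)
    · by_contra! h₆
      have := (key u' h' (by linarith) h₄ h₅ (Or.inr ⟨h₃, h₆⟩)).1
      linarith
  · rintro ⟨hr, hb⟩
    refine ⟨(L.not_mem_iff hu hua).2 hr.2.1, fun y hy hle => ?_⟩
    obtain ⟨u', h', hu', hua', rfl⟩ := L.exists_repr y
    rw [L.not_mem_iff hu' hua'] at hy
    rw [semigroupLE, L.sub_mem_iff hu hua hu' hua'] at hle
    rcases hle with ⟨h₁, h₂⟩ | ⟨h₁, h₂⟩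
    · rcases hr.2.2 u' h' hu' h₁ hy with ⟨rfl, rfl⟩ | h₃
      · rfl
      · linarith
    · linarith [hb u' h' h₁ hua' hy]

theorem record_le {lo u h : ℤ} (hd : 0 < (d : ℤ)) (hr : IsRecord d m B lo u h) :
    u * m - h * d - B ≤ d := by
  by_contra! hlt
  rcases hr.2.2 u (h + 1) hr.1 le_rfl (by linarith) with ⟨-, h₁⟩ | h₁ <;> linarith

/-- If `d < b`, the pseudo-Frobenius numbers correspond to the records over `u ≥ 1`. -/
theorem mem_pseudoFrobenius_iff_of_lt (L : IsLatticeDatum a b d m τ f B) (hdb : d < b) {u h : ℤ}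
    (hu : 1 ≤ u) (hua : u ≤ a) :
    a * f + a + a * h - τ * u ∈ pseudoFrobenius (semigroupQuotient (genTwo a b) d) ↔
      IsRecord d m B 1 u h := by
  rw [L.mem_pseudoFrobenius_iff hu hua]
  refine ⟨fun h => h.1, fun hr => ⟨hr, fun u' h' _ _ h₃ => ?_⟩⟩
  have h₁ := record_le (by linarith [L.B_pos, L.B_lt]) hr
  have h₂ : (d : ℤ) < b := by exact_mod_cast hdb
  linarith

theorem not_dvd (L : IsLatticeDatum a b d m τ f B) (hbd : b.Coprime d) {u : ℤ} (hu : 0 < u)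
    (hud : u < d) : ¬ (d : ℤ) ∣ u * m := by
  intro h
  have h₁ : IsCoprime (d : ℤ) m := by
    obtain ⟨x, y, hxy⟩ := (Nat.isCoprime_iff_coprime.2 hbd : IsCoprime (b : ℤ) d)
    exact ⟨x * τ + y, -x * a, by linear_combination hxy + x * L.tau_mul⟩
  have := Int.le_of_dvd hu (h₁.dvd_of_dvd_mul_right h)
  linarith

/-- A record over `u ≥ 1` is a record over `u ≥ 0` if and only if it is below the value at `0`. -/
theorem record_zero_iff (L : IsLatticeDatum a b d m τ f B) {u h : ℤ} (hu : 1 ≤ u) :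
    IsRecord d m B 0 u h ↔ IsRecord d m B 1 u h ∧ u * m - h * d - B < d - B := by
  have hB := L.B_pos
  have hBd := L.B_lt
  have hd : (0 : ℤ) < d := by linarith
  constructor
  · intro hr
    refine ⟨⟨hu, hr.2.1, fun u' h' h₁ => hr.2.2 u' h' (by linarith)⟩, ?_⟩
    rcases hr.2.2 0 (-1) le_rfl hr.1 (by linarith) with ⟨h₁, -⟩ | h₁ <;> linarith
  · rintro ⟨hr, hlt⟩
    refine ⟨by linarith, hr.2.1, fun u' h' h₁ h₂ h₃ => ?_⟩
    rcases h₁.eq_or_lt with rfl | h₁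
    · right
      have : h' ≤ -1 := by
        by_contra! h₄
        nlinarith [mul_nonneg (show 0 ≤ h' by omega) hd.le]
      nlinarith
    · exact hr.2.2 u' h' h₁ h₂ h₃

/-- If `b < d` and `1` is not in the quotient, the pseudo-Frobenius numbers correspond to the
records over `u ≥ 0`. -/
theorem mem_pseudoFrobenius_iff_of_gt (L : IsLatticeDatum a b d m τ f B) (hm : 0 < m)
    (hb : b < d) (hdS : d ∉ genTwo a b) {u h : ℤ} (hu : 1 ≤ u) (hua : u ≤ a) :
    a * f + a + a * h - τ * u ∈ pseudoFrobenius (semigroupQuotient (genTwo a b) d) ↔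
      IsRecord d m B 0 u h := by
  have hB := L.B_pos
  have hBd := L.B_lt
  have had : (a : ℤ) < d := by exact_mod_cast L.a_lt
  have ha0 : (0 : ℤ) < a := by linarith
  have hd : (0 : ℤ) < d := by linarith
  have hb' : (b : ℤ) < d := by exact_mod_cast hb
  have hbe := L.b_eq
  have hf : f = 0 := by
    have h₁ : f < 1 := by nlinarith
    have h₂ : -1 < f := by
      have : (0 : ℤ) ≤ b := by positivity
      nlinarith
    omega
  subst hf
  have hbB : (b : ℤ) = d - B := by linarith
  constructor
  · intro hpf
    rw [L.record_zero_iff hu]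
    refine ⟨((L.mem_pseudoFrobenius_iff hu hua).1 hpf).1, ?_⟩
    by_contra! hge
    have hτ : 0 < τ := by
      have h₁ : 0 < τ * d := by rw [L.tau_mul]; nlinarith
      exact pos_of_mul_pos_left h₁ hd.le
    have hmem : τ * u + a * (-(h + 1)) ∈ intCarrier (semigroupQuotient (genTwo a b) d) :=
      L.mem_iff_exists.2 ⟨u, -(h + 1), by linarith, by linarith, rfl⟩
    obtain ⟨g, hg, hgx⟩ := hmem
    have hg0 : 0 < g := by
      have h₁ : (0 : ℤ) < d * g := by
        have h₂ : (d : ℤ) * g = a * (u * m - (h + 1) * d) + b * u := by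
          rw [hgx]; linear_combination u * L.tau_mul
        have h₃ : 0 ≤ (a : ℤ) * (u * m - (h + 1) * d) := mul_nonneg ha0.le (by linarith)
        have h₄ : (0 : ℤ) < b * u := mul_pos (by linarith) (by linarith)
        linarith
      have := pos_of_mul_pos_right h₁ hd.le
      exact_mod_cast this
    have hpf' : -(g : ℤ) ∈ pseudoFrobenius (semigroupQuotient (genTwo a b) d) := by
      rw [hgx]
      convert hpf using 1
      ring
    have hdvd := dvd_of_neg_mem_pseudoFrobenius hg0 hpf'
    have hga : (g : ℤ) ∣ a := by
      have : (a : ℤ) ∈ intCarrier (semigroupQuotient (genTwo a b) d) :=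
        L.mem_iff_exists.2 ⟨0, 1, le_rfl, by linarith, by ring⟩
      obtain ⟨n, hn, hna⟩ := this
      rw [← hna]
      exact_mod_cast hdvd n hn
    have hgτ : (g : ℤ) ∣ τ := by
      have : τ ∈ intCarrier (semigroupQuotient (genTwo a b) d) :=
        L.mem_iff_exists.2 ⟨1, 0, by norm_num, by linarith, by ring⟩
      obtain ⟨n, hn, hna⟩ := this
      rw [← hna]
      exact_mod_cast hdvd n hn
    have hg1 : g = 1 := by
      have := Int.isUnit_iff.1 (L.isCoprime.isUnit_of_dvd' hga hgτ)
      omega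
    subst hg1
    apply hdS
    have : d * 1 ∈ genTwo a b := hg
    rwa [mul_one] at this
  · intro hr
    have hr' := (L.record_zero_iff hu).1 hr
    refine (L.mem_pseudoFrobenius_iff hu hua).2 ⟨hr'.1, fun u' h' _ _ h₃ => ?_⟩
    linarith [hr'.2]

/-- The records are attained before `a`. -/
theorem lt_of_record (L : IsLatticeDatum a b d m τ f B) {H : ℤ} (hH : a * m - H * d - B = 0)
    {u h : ℤ} (hu : 1 ≤ u) (hua : u ≤ a) (hr : IsRecord d m B 1 u h) : u < a := by
  rcases hua.eq_or_lt with rfl | hlt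
  · exfalso
    have hd : (0 : ℤ) < d := by linarith [L.B_pos, L.B_lt]
    have ha : (1 : ℤ) < a := by exact_mod_cast L.a_pos
    have h₁ : (d : ℤ) ≤ a * m - h * d - B := by
      have h₂ := hr.2.1
      have h₃ : a * m - h * d - B = (H - h) * d := by linear_combination hH
      rw [h₃] at h₂ ⊢
      have := pos_of_mul_pos_left h₂ hd.le
      nlinarith
    obtain ⟨h', hp, hle⟩ : ∃ h' : ℤ, 0 < 1 * m - h' * d - B ∧ 1 * m - h' * d - B ≤ d := by
      refine ⟨(m - B - 1) / d, ?_, ?_⟩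
      · have := Int.emod_nonneg (m - B - 1) hd.ne'
        have := Int.emod_add_mul_ediv (m - B - 1) d
        linarith
      · have := Int.emod_lt_of_pos (m - B - 1) hd
        have := Int.emod_add_mul_ediv (m - B - 1) d
        linarith
    rcases hr.2.2 1 h' le_rfl ha.le hp with ⟨h₂, -⟩ | h₂ <;> linarith
  · exact hlt

end IsLatticeDatum

theorem kZero_spec {s : ℕ} {e : ℕ → ℕ} (hs : 1 ≤ s) (hes : 0 < e s) :
    ∃ l, kZero s e = l + 1 ∧ 2 * l + 1 ≤ s ∧ (∀ k < l, e (2 * k + 2) = 0) ∧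
      (2 * l + 1 = s ∨ (2 * l + 2 ≤ s ∧ 0 < e (2 * l + 2))) := by
  by_cases h : (evenSupport s e).Nonempty
  · have hK : kZero s e = (evenSupport s e).min' h := dif_pos h
    have hmem := Finset.min'_mem _ h
    rw [← hK, evenSupport, Finset.mem_filter, Finset.mem_Icc] at hmem
    obtain ⟨l, hl⟩ : ∃ l, kZero s e = l + 1 := ⟨kZero s e - 1, by omega⟩
    rw [hl, show 2 * (l + 1) = 2 * l + 2 by ring] at hmem
    refine ⟨l, hl, by omega, fun k hk => ?_, Or.inr ⟨by omega, by omega⟩⟩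
    by_contra h0
    have : (evenSupport s e).min' h ≤ k + 1 := Finset.min'_le _ _ (by
      rw [evenSupport, Finset.mem_filter, Finset.mem_Icc]
      exact ⟨by omega, h0⟩)
    omega
  · have hK : kZero s e = (s + 1) / 2 := dif_neg h
    have h0 : ∀ k, 1 ≤ k → k ≤ s / 2 → e (2 * k) = 0 := by
      intro k h₁ h₂
      by_contra h₃
      exact h ⟨k, by rw [evenSupport, Finset.mem_filter, Finset.mem_Icc]; exact ⟨⟨h₁, h₂⟩, h₃⟩⟩
    rcases Nat.even_or_odd' s with ⟨n, hn | hn⟩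
    · have := h0 n (by omega) (by omega)
      rw [← hn] at this
      omega
    · refine ⟨n, by omega, by omega, fun k hk => h0 (k + 1) (by omega) (by omega), Or.inl hn.symm⟩

theorem muSeq_eq {c : ℕ → ℕ} (hc : c 0 = 0) (a : ℕ) (τ : ℤ) (n : ℕ) :
    muSeq a τ c n = τ * shiftDen c (n + 1) - a * shiftNum c (n + 1) := by
  rw [muSeq, convDen_eq_shiftDen, convNum_eq_shiftNum hc]

theorem mem_setF1_iff {a b d : ℕ} {τ : ℤ} {c : ℕ → ℕ} (hc : c 0 = 0) {s l : ℕ} {e : ℕ → ℕ}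
    (hl : kZero s e = l + 1) {x : ℤ} :
    x ∈ setF1 a b d τ c s e ↔ ∃ k ∈ Finset.range l, ∃ j ∈ Finset.Icc 1 (c (2 * k + 2)),
      x = a * ⌊(b : ℚ) / d⌋ + a + a * (shiftNum c (2 * k + 1) + j * shiftNum c (2 * k + 2) - 1)
        - τ * (shiftDen c (2 * k + 1) + j * shiftDen c (2 * k + 2)) := by
  have hx : ∀ k j : ℕ, (a : ℤ) * ⌊(b : ℚ) / d⌋ - muSeq a τ c (2 * (k + 1) - 2)
        - (j : ℤ) * muSeq a τ c (2 * (k + 1) - 1)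
      = a * ⌊(b : ℚ) / d⌋ + a + a * (shiftNum c (2 * k + 1) + j * shiftNum c (2 * k + 2) - 1)
        - τ * (shiftDen c (2 * k + 1) + j * shiftDen c (2 * k + 2)) := by
    intro k j
    rw [show 2 * (k + 1) - 2 = 2 * k by omega, show 2 * (k + 1) - 1 = 2 * k + 1 by omega,
      muSeq_eq hc, muSeq_eq hc]
    ring
  constructor
  · rintro ⟨k, hk, j, hj, rfl⟩
    rw [Finset.mem_Icc] at hk
    obtain ⟨k, rfl⟩ : ∃ i, k = i + 1 := ⟨k - 1, by omega⟩
    exact ⟨k, Finset.mem_range.2 (by omega), j, hj, hx k j⟩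
  · rintro ⟨k, hk, j, hj, rfl⟩
    rw [Finset.mem_range] at hk
    exact ⟨k + 1, Finset.mem_Icc.2 (by omega), j, hj, (hx k j).symm⟩

theorem mem_setF2_iff {a b d : ℕ} {τ : ℤ} {c : ℕ → ℕ} (hc : c 0 = 0) {s : ℕ} {e : ℕ → ℕ} {x : ℤ} :
    x ∈ setF2 a b d τ c s e ↔ ∃ k ∈ Finset.range (s / 2), ∃ j ∈ Finset.range (e (2 * k + 2)),
      x = a * ⌊(b : ℚ) / d⌋ + a + a * (digitNum c e (2 * k + 1) + j * shiftNum c (2 * k + 2))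
        - τ * (digitDen c e (2 * k + 1) + j * shiftDen c (2 * k + 2)) := by
  have hx : ∀ k j : ℕ, (a : ℤ) * ⌊(b : ℚ) / d⌋ + a - (j : ℤ) * muSeq a τ c (2 * (k + 1) - 1)
        - ∑ i ∈ Finset.Icc 1 (2 * (k + 1) - 1), (e i : ℤ) * muSeq a τ c (i - 1)
      = a * ⌊(b : ℚ) / d⌋ + a + a * (digitNum c e (2 * k + 1) + j * shiftNum c (2 * k + 2))
        - τ * (digitDen c e (2 * k + 1) + j * shiftDen c (2 * k + 2)) := by
    intro k j
    have hsum : ∑ i ∈ Finset.Icc 1 (2 * k + 1), (e i : ℤ) * muSeq a τ c (i - 1)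
        = τ * digitDen c e (2 * k + 1) - a * digitNum c e (2 * k + 1) := by
      rw [← sum_Icc_mul_form]
      refine Finset.sum_congr rfl fun i hi => ?_
      rw [Finset.mem_Icc] at hi
      rw [muSeq_eq hc, Nat.sub_add_cancel hi.1]
    rw [show 2 * (k + 1) - 1 = 2 * k + 1 by omega, muSeq_eq hc, hsum]
    ring
  constructor
  · rintro ⟨k, hk, j, hj, rfl⟩
    rw [evenSupport, Finset.mem_filter, Finset.mem_Icc] at hk
    obtain ⟨k, rfl⟩ : ∃ i, k = i + 1 := ⟨k - 1, by omega⟩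
    exact ⟨k, Finset.mem_range.2 (by omega), j, Finset.mem_range.2 hj, hx k j⟩
  · rintro ⟨k, hk, j, hj, rfl⟩
    rw [Finset.mem_range] at hk hj
    refine ⟨k + 1, ?_, j, hj, (hx k j).symm⟩
    rw [evenSupport, Finset.mem_filter, Finset.mem_Icc]
    refine ⟨by omega, ?_⟩
    rw [show 2 * (k + 1) = 2 * k + 2 by ring]
    omega

namespace IsDigitExpansion

variable {d m B : ℤ} {s : ℕ} {c e : ℕ → ℕ}

theorem high_bounds (E : IsDigitExpansion d m B s c e) {k j : ℕ} (hk : k < s / 2)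
    (hj : j < e (2 * k + 2)) :
    1 ≤ digitDen c e (2 * k + 1) + j * shiftDen c (2 * k + 2) ∧
    digitDen c e (2 * k) ≤ digitDen c e (2 * k + 1) + j * shiftDen c (2 * k + 2) ∧
    digitDen c e (2 * k + 1) + j * shiftDen c (2 * k + 2) < digitDen c e (2 * k + 2) := by
  have h₁ := E.shiftDen_pos (n := 2 * k + 1) (by omega)
  have h₂ : digitDen c e 1 ≤ digitDen c e (2 * k + 1) := digitDen_mono c e (by omega)
  have h₃ : digitDen c e 1 = e 1 := by simp [digitDen, shiftDen]
  have h₄ : (1 : ℤ) ≤ e 1 := by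
    have := E.digit_pos_of_even_digits_eq_zero (l := 0) E.one_le (by simp)
    exact_mod_cast this
  have h₅ : 0 ≤ j * shiftDen c (2 * k + 2) := mul_nonneg (by positivity) (shiftDen_nonneg c _)
  have h₆ : digitDen c e (2 * k) ≤ digitDen c e (2 * k + 1) := digitDen_mono c e (by omega)
  have h₇ : digitDen c e (2 * k + 2)
    = digitDen c e (2 * k + 1) + e (2 * k + 2) * shiftDen c (2 * k + 2) := rfl
  have h₈ : (j : ℤ) + 1 ≤ e (2 * k + 2) := by exact_mod_cast hj
  refine ⟨by linarith, by linarith, ?_⟩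
  rw [h₇]
  nlinarith

theorem low_bounds (E : IsDigitExpansion d m B s c e) {l : ℕ} (hl : 2 * l + 1 ≤ s)
    (h0 : ∀ k < l, e (2 * k + 2) = 0) {k j : ℕ} (hk : k < l)
    (hj : j ∈ Finset.Icc 1 (c (2 * k + 2))) :
    shiftDen c (2 * k + 1) < shiftDen c (2 * k + 1) + j * shiftDen c (2 * k + 2) ∧
    1 < shiftDen c (2 * k + 1) + j * shiftDen c (2 * k + 2) ∧
    shiftDen c (2 * k + 1) + j * shiftDen c (2 * k + 2) ≤ shiftDen c (2 * (k + 1) + 1) ∧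
    shiftDen c (2 * k + 1) + j * shiftDen c (2 * k + 2) < digitDen c e s := by
  rw [Finset.mem_Icc] at hj
  have h₁ := E.shiftDen_pos (n := 2 * k) (by omega)
  have h₂ := E.shiftDen_pos (n := 2 * k + 1) (by omega)
  have h₃ : 0 < j * shiftDen c (2 * k + 2) := mul_pos (by exact_mod_cast hj.1) h₂
  refine ⟨by linarith, by linarith, intermediate_le c (Nat.lt_succ_self k) hj.2, ?_⟩
  have h₄ := intermediate_le c hk hj.2
  have h₅ := E.digitDen_odd_of_even_digits_eq_zero hl h0
  have h₆ : (1 : ℤ) ≤ e (2 * l + 1) := by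
    exact_mod_cast E.digit_pos_of_even_digits_eq_zero hl h0
  obtain ⟨n, rfl⟩ : ∃ n, l = n + 1 := ⟨l - 1, by omega⟩
  have h₇ : 0 < shiftDen c (2 * (n + 1)) := E.shiftDen_pos (n := 2 * n + 1) (by omega)
  have h₈ := shiftDen_nonneg c (2 * (n + 1) + 1)
  have h₉ : digitDen c e (2 * (n + 1) + 1) ≤ digitDen c e s := digitDen_mono c e hl
  nlinarith

end IsDigitExpansion

namespace IsLatticeDatum

variable {a b d : ℕ} {m τ B : ℤ} {s : ℕ} {c e : ℕ → ℕ}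

theorem mem_setF2_repr_iff (L : IsLatticeDatum a b d m τ ⌊(b : ℚ) / d⌋ B)
    (E : IsDigitExpansion d m B s c e) (ha : digitDen c e s = a) (hc : c 0 = 0) {u h : ℤ}
    (hu : 1 ≤ u) (hua : u < a) :
    a * ⌊(b : ℚ) / d⌋ + a + a * h - τ * u ∈ setF2 a b d τ c s e ↔ IsRecord d m B 0 u h := by
  have hd : (0 : ℤ) < d := by linarith [L.B_pos, L.B_lt]
  rw [mem_setF2_iff hc, E.record_iff hd L.B_pos.le L.B_lt (by linarith) (by rw [ha]; exact hua)]
  simp only [Finset.mem_range]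
  constructor
  · rintro ⟨k, hk, j, hj, heq⟩
    obtain ⟨h₁, -, h₂⟩ := E.high_bounds hk hj
    have h₃ : digitDen c e (2 * k + 2) ≤ a := ha ▸ digitDen_mono c e (by omega)
    exact ⟨k, hk, j, hj, L.repr_unique hu hua.le h₁ (by linarith) heq⟩
  · rintro ⟨k, hk, j, hj, rfl, rfl⟩
    exact ⟨k, hk, j, hj, rfl⟩

theorem exists_repr_of_mem_setF2 (E : IsDigitExpansion d m B s c e) (ha : digitDen c e s = a)
    (hc : c 0 = 0) {x : ℤ} (hx : x ∈ setF2 a b d τ c s e) :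
    ∃ u h : ℤ, 1 ≤ u ∧ u < a ∧ x = a * ⌊(b : ℚ) / d⌋ + a + a * h - τ * u := by
  obtain ⟨k, hk, j, hj, rfl⟩ := (mem_setF2_iff hc).1 hx
  rw [Finset.mem_range] at hk hj
  obtain ⟨h₁, -, h₂⟩ := E.high_bounds hk hj
  have h₃ : digitDen c e (2 * k + 2) ≤ a := ha ▸ digitDen_mono c e (by omega)
  exact ⟨_, _, h₁, by linarith, rfl⟩

theorem encard_setF2 (L : IsLatticeDatum a b d m τ ⌊(b : ℚ) / d⌋ B)
    (E : IsDigitExpansion d m B s c e) (ha : digitDen c e s = a) (hc : c 0 = 0) :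
    (setF2 a b d τ c s e).encard
      = ((∑ k ∈ Finset.Icc (kZero s e) (s / 2), e (2 * k) : ℕ) : ℕ∞) := by
  have hset : setF2 a b d τ c s e = {x | ∃ k ∈ Finset.range (s / 2),
      ∃ j ∈ Finset.range (e (2 * k + 2)), x = a * ⌊(b : ℚ) / d⌋ + a
        + a * (digitNum c e (2 * k + 1) + j * shiftNum c (2 * k + 2))
        - τ * (digitDen c e (2 * k + 1) + j * shiftDen c (2 * k + 2))} := by
    ext x
    exact mem_setF2_iff hc
  have hle : ∀ k, k < s / 2 → digitDen c e (2 * k + 2) ≤ a := fun k hk =>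
    ha ▸ digitDen_mono c e (by omega)
  rw [hset, encard_blocks (I := Finset.range (s / 2)) (J := fun k => Finset.range (e (2 * k + 2)))
    (X := fun k j => a * ⌊(b : ℚ) / d⌋ + a
      + a * (digitNum c e (2 * k + 1) + j * shiftNum c (2 * k + 2))
      - τ * (digitDen c e (2 * k + 1) + j * shiftDen c (2 * k + 2)))
    (g := fun k => digitDen c e (2 * k) - 1)
    (U := fun k j => digitDen c e (2 * k + 1) + j * shiftDen c (2 * k + 2))]
  · congr 1
    obtain ⟨l, hl, hls, h0, -⟩ := kZero_spec E.one_le E.last_pos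
    rw [hl]
    simp only [Finset.card_range]
    have h₁ : ∑ k ∈ Finset.range (s / 2), e (2 * k + 2)
        = ∑ k ∈ Finset.Icc 1 (s / 2), e (2 * k) := by
      rw [Finset.range_eq_Ico, ← Finset.Ico_add_one_right_eq_Icc,
        ← Finset.sum_Ico_add' (fun k => e (2 * k)) 0 (s / 2) 1]
      rfl
    rw [h₁]
    symm
    refine Finset.sum_subset (Finset.Icc_subset_Icc_left (by omega)) fun k hk hk' => ?_
    rw [Finset.mem_Icc] at hk hk'
    obtain ⟨i, rfl⟩ : ∃ i, k = i + 1 := ⟨k - 1, by omega⟩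
    exact h0 i (by omega)
  · intro k k' hk
    exact sub_le_sub_right (digitDen_mono c e (by omega)) 1
  · intro k hk j hj
    rw [Finset.mem_range] at hk hj
    obtain ⟨-, h₁, h₂⟩ := E.high_bounds hk hj
    constructor
    · linarith
    · show _ ≤ digitDen c e (2 * k + 2) - 1
      linarith
  · intro k hk j hj j' hj' heq
    rw [Finset.mem_range] at hk
    have h₁ := E.shiftDen_pos (n := 2 * k + 1) (by omega)
    have h₂ : (j : ℤ) * shiftDen c (2 * k + 2) = j' * shiftDen c (2 * k + 2) := by
      linarith [show _ = _ from heq]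
    exact_mod_cast mul_right_cancel₀ h₁.ne' h₂
  · intro k hk j hj k' hk' j' hj' heq
    rw [Finset.mem_range] at hk hj hk' hj'
    obtain ⟨h₁, -, h₂⟩ := E.high_bounds hk hj
    obtain ⟨h₃, -, h₄⟩ := E.high_bounds hk' hj'
    have h₅ := hle k hk
    have h₆ := hle k' hk'
    exact (L.repr_unique h₁ (by linarith) h₃ (by linarith) heq).1

theorem encard_setF1 (L : IsLatticeDatum a b d m τ ⌊(b : ℚ) / d⌋ B)
    (E : IsDigitExpansion d m B s c e) (ha : digitDen c e s = a) (hc : c 0 = 0) :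
    (setF1 a b d τ c s e).encard
      = ((∑ k ∈ Finset.Icc 1 (kZero s e - 1), c (2 * k) : ℕ) : ℕ∞) := by
  obtain ⟨l, hl, hls, h0, -⟩ := kZero_spec E.one_le E.last_pos
  have hset : setF1 a b d τ c s e = {x | ∃ k ∈ Finset.range l,
      ∃ j ∈ Finset.Icc 1 (c (2 * k + 2)), x = a * ⌊(b : ℚ) / d⌋ + a
        + a * (shiftNum c (2 * k + 1) + j * shiftNum c (2 * k + 2) - 1)
        - τ * (shiftDen c (2 * k + 1) + j * shiftDen c (2 * k + 2))} := by
    ext x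
    exact mem_setF1_iff hc hl
  rw [hset, encard_blocks (I := Finset.range l) (J := fun k => Finset.Icc 1 (c (2 * k + 2)))
    (X := fun k j => a * ⌊(b : ℚ) / d⌋ + a
      + a * (shiftNum c (2 * k + 1) + j * shiftNum c (2 * k + 2) - 1)
      - τ * (shiftDen c (2 * k + 1) + j * shiftDen c (2 * k + 2)))
    (g := fun k => shiftDen c (2 * k + 1))
    (U := fun k j => shiftDen c (2 * k + 1) + j * shiftDen c (2 * k + 2))]
  · congr 1
    rw [hl]
    simp only [Nat.card_Icc, Nat.add_sub_cancel]
    rw [Finset.range_eq_Ico, ← Finset.Ico_add_one_right_eq_Icc,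
      ← Finset.sum_Ico_add' (fun k => c (2 * k)) 0 l 1]
    rfl
  · exact IsDigitExpansion.shiftDen_odd_mono c
  · intro k hk j hj
    rw [Finset.mem_range] at hk
    obtain ⟨h₁, -, h₂, -⟩ := E.low_bounds hls h0 hk hj
    exact ⟨h₁, h₂⟩
  · intro k hk j hj j' hj' heq
    rw [Finset.mem_range] at hk
    have h₁ := E.shiftDen_pos (n := 2 * k + 1) (by omega)
    have h₂ : (j : ℤ) * shiftDen c (2 * k + 2) = j' * shiftDen c (2 * k + 2) := by
      linarith [show _ = _ from heq]
    exact_mod_cast mul_right_cancel₀ h₁.ne' h₂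
  · intro k hk j hj k' hk' j' hj' heq
    rw [Finset.mem_range] at hk hk'
    obtain ⟨-, h₁, -, h₂⟩ := E.low_bounds hls h0 hk hj
    obtain ⟨-, h₃, -, h₄⟩ := E.low_bounds hls h0 hk' hj'
    rw [ha] at h₂ h₄
    exact (L.repr_unique h₁.le h₂.le h₃.le h₄.le heq).1

theorem pseudoFrobenius_of_gt (L : IsLatticeDatum a b d m τ ⌊(b : ℚ) / d⌋ B)
    (E : IsDigitExpansion d m B s c e) (ha : digitDen c e s = a) (hc : c 0 = 0)
    (hb : b < d) (hdS : d ∉ genTwo a b) :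
    pseudoFrobenius (semigroupQuotient (genTwo a b) d) = setF2 a b d τ c s e := by
  have hm : 0 < m := E.rem_pos 1 (by omega)
  have hH := E.form_eq_zero
  rw [ha] at hH
  ext x
  constructor
  · intro hx
    obtain ⟨u, h, hu, hua, rfl⟩ := L.exists_repr x
    have hr := (L.mem_pseudoFrobenius_iff_of_gt hm hb hdS hu hua).1 hx
    have hlt := L.lt_of_record hH hu hua ((L.record_zero_iff hu).1 hr).1
    exact (L.mem_setF2_repr_iff E ha hc hu hlt).2 hr
  · intro hx
    obtain ⟨u, h, hu, hua, rfl⟩ := exists_repr_of_mem_setF2 E ha hc hx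
    exact (L.mem_pseudoFrobenius_iff_of_gt hm hb hdS hu hua.le).2
      ((L.mem_setF2_repr_iff E ha hc hu hua).1 hx)

theorem mem_low_repr_iff (L : IsLatticeDatum a b d m τ ⌊(b : ℚ) / d⌋ B)
    (E : IsDigitExpansion d m B s c e) (ha : digitDen c e s = a) (hc : c 0 = 0)
    (hbd : b.Coprime d) (hmd : m < d) {α β : ℚ} (hαβ : α < β ↔ m < B) {u h : ℤ}
    (hu : 1 ≤ u) (hua : u < a) :
    a * ⌊(b : ℚ) / d⌋ + a + a * h - τ * u ∈ setF0 a b d τ α β ∪ setF1 a b d τ c s e ↔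
      IsRecord d m B 1 u h ∧ d - B < u * m - h * d - B := by
  obtain ⟨l, hl, hls, h0, hlast⟩ := kZero_spec E.one_le E.last_pos
  have ha1 : (1 : ℤ) < a := by exact_mod_cast L.a_pos
  have had : (a : ℤ) < d := by exact_mod_cast L.a_lt
  rw [E.low_record_iff L.B_pos L.B_lt hmd (by rw [ha]; exact ha1) (by rw [ha]; exact had)
    (fun u => L.not_dvd hbd) hls h0 hlast (by linarith) (by rw [ha]; exact hua), Set.mem_union,
    mem_setF1_iff hc hl]
  refine or_congr ?_ ?_
  · constructor
    · rintro ⟨h₁, h₂⟩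
      have h₃ := L.repr_unique hu hua.le le_rfl ha1.le (h' := -1) (by rw [h₂]; ring)
      exact ⟨h₃.1, h₃.2, hαβ.1 h₁⟩
    · rintro ⟨rfl, rfl, h₁⟩
      exact ⟨hαβ.2 h₁, by ring⟩
  · simp only [Finset.mem_range]
    constructor
    · rintro ⟨k, hk, j, hj, heq⟩
      obtain ⟨-, h₁, -, h₂⟩ := E.low_bounds hls h0 hk hj
      rw [ha] at h₂
      exact ⟨k, hk, j, hj, L.repr_unique hu hua.le h₁.le h₂.le heq⟩
    · rintro ⟨k, hk, j, hj, rfl, rfl⟩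
      exact ⟨k, hk, j, hj, rfl⟩

theorem exists_repr_of_mem_low (L : IsLatticeDatum a b d m τ ⌊(b : ℚ) / d⌋ B)
    (E : IsDigitExpansion d m B s c e) (ha : digitDen c e s = a) (hc : c 0 = 0) {α β : ℚ} {x : ℤ}
    (hx : x ∈ setF0 a b d τ α β ∪ setF1 a b d τ c s e) :
    ∃ u h : ℤ, 1 ≤ u ∧ u < a ∧ x = a * ⌊(b : ℚ) / d⌋ + a + a * h - τ * u := by
  obtain ⟨l, hl, hls, h0, -⟩ := kZero_spec E.one_le E.last_pos
  rcases hx with ⟨-, rfl⟩ | hx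
  · exact ⟨1, -1, le_rfl, by exact_mod_cast L.a_pos, by ring⟩
  · obtain ⟨k, hk, j, hj, rfl⟩ := (mem_setF1_iff hc hl).1 hx
    obtain ⟨-, h₁, -, h₂⟩ := E.low_bounds hls h0 (Finset.mem_range.1 hk) hj
    rw [ha] at h₂
    exact ⟨_, _, h₁.le, h₂, rfl⟩

theorem pseudoFrobenius_of_lt (L : IsLatticeDatum a b d m τ ⌊(b : ℚ) / d⌋ B)
    (E : IsDigitExpansion d m B s c e) (ha : digitDen c e s = a) (hc : c 0 = 0)
    (hbd : b.Coprime d) (hmd : m < d) {α β : ℚ} (hαβ : α < β ↔ m < B) (hdb : d < b) :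
    pseudoFrobenius (semigroupQuotient (genTwo a b) d)
      = setF0 a b d τ α β ∪ setF1 a b d τ c s e ∪ setF2 a b d τ c s e := by
  have hH := E.form_eq_zero
  rw [ha] at hH
  have had : (a : ℤ) < d := by exact_mod_cast L.a_lt
  ext x
  rw [Set.mem_union]
  constructor
  · intro hx
    obtain ⟨u, h, hu, hua, rfl⟩ := L.exists_repr x
    have hr := (L.mem_pseudoFrobenius_iff_of_lt hdb hu hua).1 hx
    have hlt := L.lt_of_record hH hu hua hr
    rw [L.mem_low_repr_iff E ha hc hbd hmd hαβ hu hlt, L.mem_setF2_repr_iff E ha hc hu hlt,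
      L.record_zero_iff hu]
    rcases lt_trichotomy (u * m - h * d - B) (d - B) with h₁ | h₁ | h₁
    · exact Or.inr ⟨hr, h₁⟩
    · exact absurd ⟨h + 1, by linarith⟩ (L.not_dvd hbd (show 0 < u by linarith) (by linarith))
    · exact Or.inl ⟨hr, h₁⟩
  · rintro (hx | hx)
    · obtain ⟨u, h, hu, hua, rfl⟩ := L.exists_repr_of_mem_low E ha hc hx
      exact (L.mem_pseudoFrobenius_iff_of_lt hdb hu hua.le).2
        ((L.mem_low_repr_iff E ha hc hbd hmd hαβ hu hua).1 hx).1
    · obtain ⟨u, h, hu, hua, rfl⟩ := exists_repr_of_mem_setF2 E ha hc hx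
      exact (L.mem_pseudoFrobenius_iff_of_lt hdb hu hua.le).2
        ((L.record_zero_iff hu).1 ((L.mem_setF2_repr_iff E ha hc hu hua).1 hx)).1

theorem disjoint_low_setF2 (L : IsLatticeDatum a b d m τ ⌊(b : ℚ) / d⌋ B)
    (E : IsDigitExpansion d m B s c e) (ha : digitDen c e s = a) (hc : c 0 = 0)
    (hbd : b.Coprime d) (hmd : m < d) {α β : ℚ} (hαβ : α < β ↔ m < B) :
    Disjoint (setF0 a b d τ α β ∪ setF1 a b d τ c s e) (setF2 a b d τ c s e) := by
  rw [Set.disjoint_left]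
  intro x hx hx'
  obtain ⟨u, h, hu, hua, rfl⟩ := L.exists_repr_of_mem_low E ha hc hx
  rw [L.mem_low_repr_iff E ha hc hbd hmd hαβ hu hua] at hx
  rw [L.mem_setF2_repr_iff E ha hc hu hua, L.record_zero_iff hu] at hx'
  linarith [hx.2, hx'.2]

theorem disjoint_setF0_setF1 (L : IsLatticeDatum a b d m τ ⌊(b : ℚ) / d⌋ B)
    (E : IsDigitExpansion d m B s c e) (ha : digitDen c e s = a) (hc : c 0 = 0) {α β : ℚ} :
    Disjoint (setF0 a b d τ α β) (setF1 a b d τ c s e) := by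
  obtain ⟨l, hl, hls, h0, -⟩ := kZero_spec E.one_le E.last_pos
  have ha1 : (1 : ℤ) < a := by exact_mod_cast L.a_pos
  rw [Set.disjoint_left]
  rintro x ⟨-, hx⟩ hx'
  obtain ⟨k, hk, j, hj, rfl⟩ := (mem_setF1_iff hc hl).1 hx'
  obtain ⟨-, h₁, -, h₂⟩ := E.low_bounds hls h0 (Finset.mem_range.1 hk) hj
  rw [ha] at h₂
  have := (L.repr_unique h₁.le h₂.le le_rfl ha1.le (h' := -1) (by rw [hx]; ring)).1
  omega

theorem digitDen_eq (L : IsLatticeDatum a b d m τ ⌊(b : ℚ) / d⌋ B)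
    (E : IsDigitExpansion d m B s c e) (hbd : b.Coprime d) {g : ℤ} (hg : a * m - g * d = B) :
    digitDen c e s = a := by
  have h₁ := E.form_eq_zero
  have h₂ := E.digitDen_lt
  have h₃ : digitDen c e 0 ≤ digitDen c e s := digitDen_mono c e (Nat.zero_le s)
  have h₄ : digitDen c e 0 = 0 := rfl
  have had : (a : ℤ) < d := by exact_mod_cast L.a_lt
  have ha : (0 : ℤ) ≤ a := by positivity
  rcases lt_trichotomy (digitDen c e s) a with h | h | h
  · exact absurd ⟨g - digitNum c e s, by linear_combination hg - h₁⟩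
      (L.not_dvd hbd (show 0 < a - digitDen c e s by linarith) (by linarith))
  · exact h
  · exact absurd ⟨digitNum c e s - g, by linear_combination h₁ - hg⟩
      (L.not_dvd hbd (show 0 < digitDen c e s - a by linarith) (by linarith))

end IsLatticeDatum

theorem theorem8 (a b d : ℕ)
    (hab : a.Coprime b) (had : a.Coprime d) (hbd : b.Coprime d)
    (h1 : 1 < min a b) (hmin : min a b < d)
    (hd : d ∉ genTwo a b)
    (hf : ¬ (d : ℤ) ∣ (a : ℤ) * b - a - b)
    (m : ℕ) (hm : m ∈ Finset.Icc 1 (d - 1)) (hmd : d ∣ a * m + b)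
    (α : ℚ) (hα : α = (m : ℚ) / d)
    (r : ℕ) (c : ℕ → ℕ) (hc : IsCFE α r c)
    (τ : ℤ) (hτ : (τ : ℚ) = ((a : ℚ) * m + b) / d)
    (β : ℚ) (hβ : β = Int.fract ((a : ℚ) * α))
    (s : ℕ) (e : ℕ → ℕ) (he : IsNumeration α r c β s e) :
    0 < τ ∧ β = 1 - Int.fract ((b : ℚ) / d) ∧ (evenSupport s e = ∅ → Odd s) ∧
    (a < d → d < b →
      pseudoFrobenius (semigroupQuotient (genTwo a b) d)
          = setF0 a b d τ α β ∪ setF1 a b d τ c s e ∪ setF2 a b d τ c s e ∧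
      Disjoint (setF0 a b d τ α β) (setF1 a b d τ c s e) ∧
      Disjoint (setF0 a b d τ α β) (setF2 a b d τ c s e) ∧
      Disjoint (setF1 a b d τ c s e) (setF2 a b d τ c s e) ∧
      semigroupType (semigroupQuotient (genTwo a b) d)
          = ((∑ k ∈ Finset.Icc 1 (kZero s e - 1), c (2 * k)
            + ∑ k ∈ Finset.Icc (kZero s e) (s / 2), e (2 * k)
            + (if α < β then 1 else 0) : ℕ) : ℕ∞)) ∧
    (max a b < d →
      pseudoFrobenius (semigroupQuotient (genTwo a b) d) = setF2 a b d τ c s e ∧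
      semigroupType (semigroupQuotient (genTwo a b) d)
          = ((∑ k ∈ Finset.Icc (kZero s e) (s / 2), e (2 * k) : ℕ) : ℕ∞)) := by
  rw [Finset.mem_Icc] at hm
  obtain ⟨ha1, hb1⟩ := lt_min_iff.1 h1
  have hd1 : 1 < d := h1.trans hmin
  have hdq : (0 : ℚ) < d := by exact_mod_cast zero_lt_one.trans hd1
  have hτd : (τ : ℚ) * d = a * m + b := by rw [hτ]; field_simp
  have hτd' : τ * d = a * m + b := by exact_mod_cast hτd
  have hfract : Int.fract ((b : ℚ) / d) ≠ 0 := by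
    intro h
    obtain ⟨z, hz⟩ := Int.fract_eq_zero_iff.1 h
    have hz' : (b : ℚ) = z * d := by rw [hz]; field_simp
    have hz'' : (b : ℤ) = z * d := by exact_mod_cast hz'
    have hdvd : d ∣ b := by
      have : (d : ℤ) ∣ b := ⟨z, by linarith⟩
      exact_mod_cast this
    have := hbd.symm.eq_one_of_dvd hdvd
    omega
  have hβ' : β = 1 - Int.fract ((b : ℚ) / d) := by
    have h₁ : (a : ℚ) * α = -((b : ℚ) / d) + τ := by
      rw [hα, hτ]; field_simp; ring
    rw [hβ, h₁, Int.fract_add_intCast, Int.fract_neg hfract]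
  have hτ0 : 0 < τ := by
    have h₁ : 0 < τ * d := by rw [hτd']; positivity
    exact pos_of_mul_pos_left h₁ (by positivity)
  set g := ⌊(a : ℚ) * α⌋ with hg
  set B : ℤ := a * m - g * d with hB
  have hβB : β * d = B := by
    rw [hβ, Int.fract, ← hg, hB, hα]
    push_cast
    field_simp
  have hB0 : 0 < B := by
    have h₁ : 0 < β := by rw [hβ']; linarith [Int.fract_lt_one ((b : ℚ) / d)]
    have h₂ : (0 : ℚ) < B := by rw [← hβB]; positivity
    exact_mod_cast h₂
  have hBd : B < d := by
    have h₁ : β < 1 := by rw [hβ]; exact Int.fract_lt_one _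
    have h₂ : (B : ℚ) < d := by rw [← hβB]; nlinarith
    exact_mod_cast h₂
  have hbB : (b : ℤ) = d * (⌊(b : ℚ) / d⌋ + 1) - B := by
    have h₁ : (b : ℚ) = d * (⌊(b : ℚ) / d⌋ + 1) - B := by
      rw [← hβB, hβ', Int.fract]
      field_simp
      ring
    exact_mod_cast h₁
  have hαβ : α < β ↔ (m : ℤ) < B := by
    rw [← mul_lt_mul_iff_left₀ hdq, hβB, hα, div_mul_cancel₀ _ hdq.ne']
    exact_mod_cast Iff.rfl
  have E : IsDigitExpansion d m B s c e := he.isDigitExpansion (by omega) (by omega)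
    (by rw [hα]; simp) (by exact_mod_cast hβB) hc
  have hodd : evenSupport s e = ∅ → Odd s := by
    intro hempty
    by_contra hs
    obtain ⟨n, hn⟩ := even_iff_two_dvd.1 (Nat.not_odd_iff_even.1 hs)
    have h₁ : n ∈ evenSupport s e := by
      rw [evenSupport, Finset.mem_filter, Finset.mem_Icc, ← hn]
      have := E.one_le
      have := E.last_pos
      omega
    rw [hempty] at h₁
    exact absurd h₁ (Finset.notMem_empty n)
  refine ⟨hτ0, hβ', hodd, fun had' hdb => ?_, fun hmax => ?_⟩
  · have L : IsLatticeDatum a b d m τ ⌊(b : ℚ) / d⌋ B :=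
      ⟨ha1, had', hab, had, hτd', hbB, hB0, hBd⟩
    have ha := L.digitDen_eq E hbd hB.symm
    have hPF := L.pseudoFrobenius_of_lt E ha hc.1 hbd (by omega) hαβ hdb
    have h01 := L.disjoint_setF0_setF1 E ha hc.1 (α := α) (β := β)
    have hdis := L.disjoint_low_setF2 E ha hc.1 hbd (by omega) hαβ
    refine ⟨hPF, h01, hdis.mono_left Set.subset_union_left,
      hdis.mono_left Set.subset_union_right, ?_⟩
    have h0 : (setF0 a b d τ α β).encard = ((if α < β then 1 else 0 : ℕ) : ℕ∞) := by
      by_cases h : α < β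
      · have : setF0 a b d τ α β = {(a : ℤ) * ⌊(b : ℚ) / d⌋ - τ} := by
          ext x; simp [setF0, h]
        rw [this, Set.encard_singleton, if_pos h, Nat.cast_one]
      · have : setF0 a b d τ α β = ∅ := by
          ext x; simp [setF0, h]
        rw [this, Set.encard_empty, if_neg h, Nat.cast_zero]
    rw [semigroupType, hPF, Set.encard_union_eq hdis, Set.encard_union_eq h01, h0,
      L.encard_setF1 E ha hc.1, L.encard_setF2 E ha hc.1]
    norm_cast
    ring
  · obtain ⟨had', hbd'⟩ := max_lt_iff.1 hmax
    have L : IsLatticeDatum a b d m τ ⌊(b : ℚ) / d⌋ B :=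
      ⟨ha1, had', hab, had, hτd', hbB, hB0, hBd⟩
    have ha := L.digitDen_eq E hbd hB.symm
    have hPF := L.pseudoFrobenius_of_gt E ha hc.1 hbd' hd
    exact ⟨hPF, by rw [semigroupType, hPF, L.encard_setF2 E ha hc.1]⟩
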